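/- Let $M$ be a smooth manifold, $g$ a smooth Riemannian metric on $M$ with Levi-Civita connection $\nabla$ and curvature tensor $R$, and $J$ a smooth $g$-orthogonal almost complex structure. Suppose that $(M,g,J)$ is locally Hermitian symmetric, i.e. Kähler ($\nabla J=0$) and locally symmetric ($\nabla R=0$). Let $\mathcal F$ be a smooth foliation of $M$ with tangent distribution $\mathcal V$, and let $\mathcal H=\mathcal V^{\perp}$ be its $g$-orthogonal complement; write $E=E_{\mathcal V}+E_{\mathcal H}$ for the corresponding decomposition of a vector field. Suppose that $\mathcal F$ is * complex: $J\mathcal V\subseteq\mathcal V$; * Riemannian: $(L_Ug)(X,Y)=0$ for all smooth sections $U$ of $\mathcal V$ and $X,Y$ of $\mathcal H$; * totally geodesic: $\nabla_UW$ is a section of $\mathcal V$ for all smooth sections $U,W$ of $\mathcal V$. Let $g^{NK}$ be the canonical variation of $g$ with parameter $t=\tfrac12$, and $\overline J$ the associated almost complex structure: $$g^{NK}(E,F)=\tfrac12\,g(E_{\mathcal V},F_{\mathcal V})+g(E_{\mathcal H},F_{\mathcal H}),\qquad \overline J E=-J E_{\mathcal V}+J E_{\mathcal H}.$$ Let $\nabla^{NK}$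 be the Levi-Civita connection of $g^{NK}$ and let $$\overline\nabla_EF=\nabla^{NK}_EF-\tfrac12\,\overline J\,(\nabla^{NK}_E\overline J)F$$ be the canonical Hermitian connection of $(g^{NK},\overline J)$. Then: 1. $(g^{NK},\overline J)$ is nearly Kähler: $\overline J$ is a $g^{NK}$-orthogonal almost complex structure with $(\nabla^{NK}_E\overline J)E=0$ for all smooth vector fields $E$. 2. On smooth vector fields, $\overline\nabla$ coincides with the Bott connection of the foliation, i.e. $\overline\nabla_EF=(\nabla_EF_{\mathcal V})_{\mathcal V}+(\nabla_EF_{\mathcal H})_{\mathcal H}$. 3. $(M,g^{NK},\overline\nabla)$ is locally homogeneous: $\overline\nabla$ is a metric connection for $g^{NK}$ ($\overline\nabla g^{NK}=0$), and its torsion $\overline T$ and curvature $\overline R$ are parallel, $\overline\nabla\,\overline T=0$ and $\overline\nabla\,\overline R=0$. -/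

import Mathlib

open Bundle
open scoped Manifold ContDiff Topology

set_option linter.unusedSectionVars false

noncomputable section

namespace RiemFol

section Basic

variable {E : Type*} [NormedAddCommGroup E] [NormedSpace ℝ E]
  {M : Type*} [TopologicalSpace M] [ChartedSpace E M]

/-- Vector fields on the manifold `M` modelled on `E` (no regularity imposed). -/
abbrev VField (E : Type*) [NormedAddCommGroup E] [NormedSpace ℝ E]
    (M : Type*) [TopologicalSpace M] [ChartedSpace E M] : Type _ :=
  (x : M) → TangentSpace 𝓘(ℝ, E) x

/-- Smooth vector fields. -/
def IsSmooth [IsManifold 𝓘(ℝ, E) 1 M] (X : VField E M) : Prop :=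
  ContMDiff 𝓘(ℝ, E) (𝓘(ℝ, E).prod 𝓘(ℝ, E)) ∞ (fun x ↦ TotalSpace.mk' E x (X x))

/-- Smooth Riemannian metrics on `M`. -/
abbrev Metric (E : Type*) [NormedAddCommGroup E] [NormedSpace ℝ E]
    (M : Type*) [TopologicalSpace M] [ChartedSpace E M] [IsManifold 𝓘(ℝ, E) 1 M] : Type _ :=
  ContMDiffRiemannianMetric 𝓘(ℝ, E) ∞ E (TangentSpace 𝓘(ℝ, E) : M → Type _)

/-- Affine connections on `M`; `D Y x (X x)` is the value at `x` of `D_X Y`. -/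
abbrev Connection (E : Type*) [NormedAddCommGroup E] [NormedSpace ℝ E]
    (M : Type*) [TopologicalSpace M] [ChartedSpace E M] [IsManifold 𝓘(ℝ, E) 1 M] : Type _ :=
  CovariantDerivative 𝓘(ℝ, E) E (TangentSpace 𝓘(ℝ, E) : M → Type _)

/-- Smooth fields of endomorphisms of the tangent bundle. -/
structure EndField (E : Type*) [NormedAddCommGroup E] [NormedSpace ℝ E]
    (M : Type*) [TopologicalSpace M] [ChartedSpace E M] [IsManifold 𝓘(ℝ, E) 1 M] where
  /-- the endomorphism at a point -/
  at' : (x : M) → TangentSpace 𝓘(ℝ, E) x →L[ℝ] TangentSpace 𝓘(ℝ, E) x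
  smooth : ContMDiff 𝓘(ℝ, E) (𝓘(ℝ, E).prod 𝓘(ℝ, E →L[ℝ] E)) ∞
    (fun x ↦ TotalSpace.mk' (E →L[ℝ] E) x (at' x))

/-- The covariant derivative `D_X Y` as a vector field. -/
def nabla [IsManifold 𝓘(ℝ, E) 1 M] (D : Connection E M) (X Y : VField E M) : VField E M :=
  fun x ↦ D Y x (X x)

/-- The vector field `A Y`, for a field `A` of endomorphisms. -/
def EndField.app [IsManifold 𝓘(ℝ, E) 1 M] (A : EndField E M) (Y : VField E M) : VField E M :=
  fun x ↦ A.at' x (Y x)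

/-- The Lie bracket of vector fields. -/
def bracket (X Y : VField E M) : VField E M :=
  fun x ↦ VectorField.mlieBracket 𝓘(ℝ, E) X Y x

/-- The function `g(X, Y)`. -/
def pair [IsManifold 𝓘(ℝ, E) 1 M] (g : Metric E M) (X Y : VField E M) : M → ℝ :=
  fun x ↦ g.inner x (X x) (Y x)

/-- The derivative `X f` of the function `f` in the direction of the vector field `X`. -/
def der (X : VField E M) (f : M → ℝ) (x : M) : ℝ :=
  mvfderiv 𝓘(ℝ, E) f x (X x)

end Basic

section LeviCivita

variable {E : Type*} [NormedAddCommGroup E] [NormedSpace ℝ E] [CompleteSpace E]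
  {M : Type*} [TopologicalSpace M] [ChartedSpace E M] [IsManifold 𝓘(ℝ, E) ∞ M]

/-- A vector field that is differentiable at `x`. -/
abbrev DiffAt (X : VField E M) (x : M) : Prop :=
  MDifferentiableAt 𝓘(ℝ, E) (𝓘(ℝ, E).prod 𝓘(ℝ, E)) (fun y ↦ TotalSpace.mk' E y (X y)) x

theorem pair_diffAt (g : Metric E M) {X Y : VField E M} {x : M}
    (hX : DiffAt X x) (hY : DiffAt Y x) : MDifferentiableAt 𝓘(ℝ, E) 𝓘(ℝ) (pair g X Y) x := by
  have hg := (g.contMDiff x).mdifferentiableAt (by simp)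
  have : MDifferentiableAt 𝓘(ℝ, E) (𝓘(ℝ, E).prod 𝓘(ℝ))
      (fun m ↦ TotalSpace.mk' ℝ (E := Bundle.Trivial M ℝ) m (g.inner m (X m) (Y m))) x := by
    apply MDifferentiableAt.clm_bundle_apply₂ (F₁ := E) (F₂ := E) hg hX hY
  simp only [mdifferentiableAt_totalSpace] at this
  exact this.2

theorem clm_comp_smooth {F₂ F₃ : Type*} [NormedAddCommGroup F₂] [NormedSpace ℝ F₂]
    [NormedAddCommGroup F₃] [NormedSpace ℝ F₃] {E₂ E₃ : M → Type*}
    [∀ x, AddCommGroup (E₂ x)] [∀ x, Module ℝ (E₂ x)] [TopologicalSpace (TotalSpace F₂ E₂)]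
    [∀ x, TopologicalSpace (E₂ x)] [FiberBundle F₂ E₂] [VectorBundle ℝ F₂ E₂]
    [∀ x, IsTopologicalAddGroup (E₂ x)] [∀ x, ContinuousSMul ℝ (E₂ x)]
    [∀ x, AddCommGroup (E₃ x)] [∀ x, Module ℝ (E₃ x)] [TopologicalSpace (TotalSpace F₃ E₃)]
    [∀ x, TopologicalSpace (E₃ x)] [FiberBundle F₃ E₃] [VectorBundle ℝ F₃ E₃]
    [∀ x, IsTopologicalAddGroup (E₃ x)] [∀ x, ContinuousSMul ℝ (E₃ x)]
    {A : (x : M) → TangentSpace 𝓘(ℝ, E) x →L[ℝ] E₂ x} {B : (x : M) → E₂ x →L[ℝ] E₃ x}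
    (hA : ContMDiff 𝓘(ℝ, E) (𝓘(ℝ, E).prod 𝓘(ℝ, E →L[ℝ] F₂)) ∞
      (fun x ↦ TotalSpace.mk' (E →L[ℝ] F₂) x (A x)))
    (hB : ContMDiff 𝓘(ℝ, E) (𝓘(ℝ, E).prod 𝓘(ℝ, F₂ →L[ℝ] F₃)) ∞
      (fun x ↦ TotalSpace.mk' (F₂ →L[ℝ] F₃) x (B x))) :
    ContMDiff 𝓘(ℝ, E) (𝓘(ℝ, E).prod 𝓘(ℝ, E →L[ℝ] F₃)) ∞
      (fun x ↦ TotalSpace.mk' (E →L[ℝ] F₃) x (B x ∘L A x)) := by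
  intro x
  have hA' := ((contMDiffAt_hom_bundle _).1 (hA x)).2
  have hB' := ((contMDiffAt_hom_bundle _).1 (hB x)).2
  refine (contMDiffAt_hom_bundle _).2 ⟨contMDiffAt_id, ?_⟩
  refine (hB'.clm_comp hA').congr_of_eventuallyEq ?_
  filter_upwards [(trivializationAt F₂ E₂ x).open_baseSet.mem_nhds
    (FiberBundle.mem_baseSet_trivializationAt' x)] with y hy
  ext v
  simp [ContinuousLinearMap.inCoordinates, hy]

theorem EndField.app_diffAt (A : EndField E M) {Y : VField E M} {x : M} (hY : DiffAt Y x) :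
    DiffAt (A.app Y) x :=
  MDifferentiableAt.clm_bundle_apply (F₁ := E) (F₂ := E)
    ((A.smooth x).mdifferentiableAt (by simp)) hY

/-- The right hand side of the Koszul formula for `2 g(∇_X Y, Z)`. -/
def koszul (g : Metric E M) (X Y Z : VField E M) (x : M) : ℝ :=
  der X (pair g Y Z) x + der Y (pair g X Z) x - der Z (pair g X Y) x
    + pair g (bracket X Y) Z x - pair g (bracket X Z) Y x - pair g (bracket Y Z) X x

theorem pair_add_left (g : Metric E M) (X X' Y : VField E M) :
    pair g (X + X') Y = pair g X Y + pair g X' Y := by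
  ext x; simp [pair]

theorem pair_add_right (g : Metric E M) (X Y Y' : VField E M) :
    pair g X (Y + Y') = pair g X Y + pair g X Y' := by
  ext x; simp [pair]

theorem pair_smul_left (g : Metric E M) (f : M → ℝ) (X Y : VField E M) :
    pair g (f • X) Y = f * pair g X Y := by
  ext x; simp [pair]

theorem pair_smul_right (g : Metric E M) (f : M → ℝ) (X Y : VField E M) :
    pair g X (f • Y) = f * pair g X Y := by
  ext x; simp [pair]

theorem pair_comm (g : Metric E M) (X Y : VField E M) : pair g X Y = pair g Y X := by
  ext x; exact g.symm x _ _

theorem der_add_fun (X : VField E M) {f h : M → ℝ} {x : M}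
    (hf : MDifferentiableAt 𝓘(ℝ, E) 𝓘(ℝ) f x) (hh : MDifferentiableAt 𝓘(ℝ, E) 𝓘(ℝ) h x) :
    der X (f + h) x = der X f x + der X h x := by
  simp [der, mvfderiv_add hf hh]

theorem der_mul_fun (X : VField E M) {f h : M → ℝ} {x : M}
    (hf : MDifferentiableAt 𝓘(ℝ, E) 𝓘(ℝ) f x) (hh : MDifferentiableAt 𝓘(ℝ, E) 𝓘(ℝ) h x) :
    der X (f * h) x = f x * der X h x + der X f x * h x := by
  simp [der, mvfderiv_mul hf hh]; ring

theorem der_add_field (X X' : VField E M) (f : M → ℝ) (x : M) :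
    der (X + X') f x = der X f x + der X' f x := by
  simp [der]

theorem der_smul_field (X : VField E M) (h f : M → ℝ) (x : M) :
    der (h • X) f x = h x * der X f x := by
  simp [der]

theorem bracket_add_left {X X' : VField E M} (Y : VField E M) {x : M}
    (hX : DiffAt X x) (hX' : DiffAt X' x) :
    bracket (X + X') Y x = bracket X Y x + bracket X' Y x :=
  VectorField.mlieBracket_add_left hX hX'

theorem bracket_add_right (X : VField E M) {Y Y' : VField E M} {x : M}
    (hY : DiffAt Y x) (hY' : DiffAt Y' x) :
    bracket X (Y + Y') x = bracket X Y x + bracket X Y' x :=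
  VectorField.mlieBracket_add_right hY hY'

theorem bracket_smul_left {f : M → ℝ} {X : VField E M} (Y : VField E M) {x : M}
    (hf : MDifferentiableAt 𝓘(ℝ, E) 𝓘(ℝ) f x) (hX : DiffAt X x) :
    bracket (f • X) Y x = -(der Y f x) • X x + f x • bracket X Y x :=
  VectorField.mlieBracket_smul_left hf hX

theorem bracket_smul_right {f : M → ℝ} (X : VField E M) {Y : VField E M} {x : M}
    (hf : MDifferentiableAt 𝓘(ℝ, E) 𝓘(ℝ) f x) (hY : DiffAt Y x) :
    bracket X (f • Y) x = der X f x • Y x + f x • bracket X Y x :=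
  VectorField.mlieBracket_smul_right hf hY

theorem koszul_tensorial₁ (g : Metric E M) {Y Z : VField E M} {x : M}
    (hY : DiffAt Y x) (hZ : DiffAt Z x) :
    TensorialAt 𝓘(ℝ, E) E (fun X : VField E M ↦ koszul g X Y Z x) x where
  smul {f X} hf hX := by
    simp only [koszul, pair_smul_left, der_smul_field, der_mul_fun _ hf (pair_diffAt g hX hY),
      der_mul_fun _ hf (pair_diffAt g hX hZ), pair_smul_right, Pi.mul_apply, smul_eq_mul]
    simp only [pair, bracket_smul_left _ hf hX, map_add, map_smul, add_apply, smul_apply,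
      smul_eq_mul]
    ring
  add {X X'} hX hX' := by
    simp only [koszul, pair_add_left, der_add_field, pair_add_right, Pi.add_apply,
      der_add_fun _ (pair_diffAt g hX hY) (pair_diffAt g hX' hY),
      der_add_fun _ (pair_diffAt g hX hZ) (pair_diffAt g hX' hZ)]
    simp only [pair, bracket_add_left _ hX hX', map_add, add_apply]
    ring

theorem koszul_tensorial₂ (g : Metric E M) {X Y : VField E M} {x : M}
    (hX : DiffAt X x) (hY : DiffAt Y x) :
    TensorialAt 𝓘(ℝ, E) E (fun Z : VField E M ↦ koszul g X Y Z x) x where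
  smul {f Z} hf hZ := by
    simp only [koszul, pair_smul_right, der_smul_field, der_mul_fun _ hf (pair_diffAt g hX hZ),
      der_mul_fun _ hf (pair_diffAt g hY hZ), Pi.mul_apply, smul_eq_mul]
    simp only [pair, bracket_smul_right _ hf hZ, map_add, map_smul, add_apply, smul_apply,
      smul_eq_mul]
    rw [g.symm x (Z x) (Y x), g.symm x (Z x) (X x)]
    ring
  add {Z Z'} hZ hZ' := by
    simp only [koszul, der_add_field, pair_add_right, Pi.add_apply,
      der_add_fun _ (pair_diffAt g hX hZ) (pair_diffAt g hX hZ'),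
      der_add_fun _ (pair_diffAt g hY hZ) (pair_diffAt g hY hZ')]
    simp only [pair, bracket_add_right _ hZ hZ', map_add, add_apply]
    ring

theorem koszul_add (g : Metric E M) {X Y Y' Z : VField E M} {x : M}
    (hX : DiffAt X x) (hY : DiffAt Y x) (hY' : DiffAt Y' x) (hZ : DiffAt Z x) :
    koszul g X (Y + Y') Z x = koszul g X Y Z x + koszul g X Y' Z x := by
  simp only [koszul, der_add_field, pair_add_right, pair_add_left, Pi.add_apply,
    der_add_fun _ (pair_diffAt g hY hZ) (pair_diffAt g hY' hZ),
    der_add_fun _ (pair_diffAt g hX hY) (pair_diffAt g hX hY')]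
  simp only [pair, bracket_add_right _ hY hY', bracket_add_left _ hY hY', map_add, add_apply]
  ring

theorem koszul_smul (g : Metric E M) {f : M → ℝ} {X Y Z : VField E M} {x : M}
    (hf : MDifferentiableAt 𝓘(ℝ, E) 𝓘(ℝ) f x)
    (hX : DiffAt X x) (hY : DiffAt Y x) (hZ : DiffAt Z x) :
    koszul g X (f • Y) Z x = f x * koszul g X Y Z x + 2 * (der X f x * pair g Y Z x) := by
  simp only [koszul, der_smul_field, pair_smul_right, pair_smul_left, Pi.mul_apply,
    der_mul_fun _ hf (pair_diffAt g hY hZ), der_mul_fun _ hf (pair_diffAt g hX hY)]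
  simp only [pair, bracket_smul_right _ hf hY, bracket_smul_left _ hf hY, map_add, map_smul,
    add_apply, smul_apply, smul_eq_mul]
  rw [g.symm x (Y x) (X x)]
  ring

variable [FiniteDimensional ℝ E]

/-- The Koszul expression as a bilinear form in the values of `X` and `Z` at `x`. -/
def koszulForm (g : Metric E M) (Y : VField E M) (x : M) (hY : DiffAt Y x) :
    TangentSpace 𝓘(ℝ, E) x →L[ℝ] (TangentSpace 𝓘(ℝ, E) x →L[ℝ] ℝ) :=
  TensorialAt.mkHom₂ (I := 𝓘(ℝ, E)) (F := E) (F' := E)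
    (fun X Z : VField E M ↦ koszul g X Y Z x) x
    (fun _ hZ ↦ koszul_tensorial₁ g hY hZ) (fun _ hX ↦ koszul_tensorial₂ g hX hY)

theorem koszulForm_apply (g : Metric E M) {X Y Z : VField E M} {x : M}
    (hX : DiffAt X x) (hY : DiffAt Y x) (hZ : DiffAt Z x) :
    koszulForm g Y x hY (X x) (Z x) = koszul g X Y Z x :=
  TensorialAt.mkHom₂_apply (I := 𝓘(ℝ, E)) (F := E) (F' := E) _ _ hX hZ

theorem exists_diffAt (x : M) (v : TangentSpace 𝓘(ℝ, E) x) :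
    ∃ X : VField E M, DiffAt X x ∧ X x = v :=
  ⟨FiberBundle.extend E v, FiberBundle.mdifferentiableAt_extend .., by simp⟩

theorem inner_isInvertible (g : Metric E M) (x : M) : (g.inner x).IsInvertible := by
  have hfin : FiniteDimensional ℝ (TangentSpace 𝓘(ℝ, E) x) :=
    inferInstanceAs (FiniteDimensional ℝ E)
  have ht2 : T2Space (TangentSpace 𝓘(ℝ, E) x) := inferInstanceAs (T2Space E)
  let c : (TangentSpace 𝓘(ℝ, E) x →ₗ[ℝ] ℝ) ≃ₗ[ℝ] (TangentSpace 𝓘(ℝ, E) x →L[ℝ] ℝ) :=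
    LinearMap.toContinuousLinearMap
  have hfin' : FiniteDimensional ℝ (TangentSpace 𝓘(ℝ, E) x →L[ℝ] ℝ) := c.finiteDimensional
  have hb : Function.Injective (g.inner x).toLinearMap := by
    rw [injective_iff_map_eq_zero]
    intro v hv
    by_contra hne
    have h0 : g.inner x v v = 0 := by
      have : g.inner x v = 0 := hv
      rw [this]; rfl
    exact (g.pos x v hne).ne' h0
  have hd : Module.finrank ℝ (TangentSpace 𝓘(ℝ, E) x)
      = Module.finrank ℝ (TangentSpace 𝓘(ℝ, E) x →L[ℝ] ℝ) := by
    rw [← c.finrank_eq]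
    exact (Subspace.dual_finrank_eq (K := ℝ) (V := TangentSpace 𝓘(ℝ, E) x)).symm
  have ht2' : T2Space (TangentSpace 𝓘(ℝ, E) x →L[ℝ] ℝ) := inferInstanceAs (T2Space (E →L[ℝ] ℝ))
  let e := LinearMap.linearEquivOfInjective (g.inner x).toLinearMap hb hd
  have hc : Continuous e.symm := LinearMap.continuous_of_finiteDimensional e.symm.toLinearMap
  exact ⟨⟨e, (g.inner x).continuous, hc⟩, by ext v w; rfl⟩

/-- The Levi-Civita connection of the Riemannian metric `g`, given by the Koszul formula
`2 g(∇_X Y, Z) = X g(Y,Z) + Y g(X,Z) - Z g(X,Y) + g([X,Y],Z) - g([X,Z],Y) - g([Y,Z],X)`. -/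
def leviCivita (g : Metric E M) : Connection E M where
  toFun Y x := open Classical in
    if hY : DiffAt Y x then (1 / 2 : ℝ) • (g.inner x).inverse ∘L koszulForm g Y x hY else 0
  isCovariantDerivativeOnUniv :=
    { add := by
        intro Y Y' x hY hY' _
        have hs : DiffAt (Y + Y') x := mdifferentiableAt_add_section hY hY'
        have key : koszulForm g (Y + Y') x hs = koszulForm g Y x hY + koszulForm g Y' x hY' := by
          ext v w
          obtain ⟨X, hX, rfl⟩ := exists_diffAt x v
          obtain ⟨Z, hZ, rfl⟩ := exists_diffAt x w
          simp [koszulForm_apply, hX, hZ, koszul_add g hX hY hY' hZ]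
        rw [dif_pos hs, dif_pos hY, dif_pos hY', key]
        ext v
        simp
      leibniz := by
        intro Y f x hY hf _
        have hs : DiffAt (f • Y) x := hf.smul_section hY
        have key (v : TangentSpace 𝓘(ℝ, E) x) : koszulForm g (f • Y) x hs v =
            f x • koszulForm g Y x hY v
              + (2 * mvfderiv 𝓘(ℝ, E) f x v) • g.inner x (Y x) := by
          ext w
          obtain ⟨X, hX, rfl⟩ := exists_diffAt x v
          obtain ⟨Z, hZ, rfl⟩ := exists_diffAt x w
          simp [koszulForm_apply, hX, hZ, koszul_smul g hf hX hY hZ, der, pair]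
          ring
        have hinv : (g.inner x).inverse (g.inner x (Y x)) = Y x := by
          obtain ⟨e, he⟩ := inner_isInvertible g x
          rw [← he]
          simp
        rw [dif_pos hs, dif_pos hY]
        ext v
        simp [key, hinv, smul_smul]
        module }

/-- The curvature of a connection: the vector field
`D_X D_Y Z - D_Y D_X Z - D_[X,Y] Z`. -/
def curvature (D : Connection E M) (X Y Z : VField E M) : VField E M :=
  nabla D X (nabla D Y Z) - nabla D Y (nabla D X Z) - nabla D (bracket X Y) Z

/-- The torsion of a connection, evaluated on vector fields. -/
def torsionField (D : Connection E M) (X Y : VField E M) : VField E M :=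
  fun x ↦ D.torsion x (X x) (Y x)

/-- `D T = 0` for the torsion `T` of `D`. -/
def HasParallelTorsion (D : Connection E M) : Prop :=
  ∀ W X Y : VField E M, IsSmooth W → IsSmooth X → IsSmooth Y →
    nabla D W (torsionField D X Y) =
      torsionField D (nabla D W X) Y + torsionField D X (nabla D W Y)

/-- `D R = 0` for the curvature `R` of `D`. -/
def HasParallelCurvature (D : Connection E M) : Prop :=
  ∀ W X Y Z : VField E M, IsSmooth W → IsSmooth X → IsSmooth Y → IsSmooth Z →
    nabla D W (curvature D X Y Z) =
      curvature D (nabla D W X) Y Z + curvature D X (nabla D W Y) Z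
        + curvature D X Y (nabla D W Z)

/-- The connection `D` is metric for `g`, i.e. `D g = 0`. -/
def IsMetricConnection (g : Metric E M) (D : Connection E M) : Prop :=
  ∀ X Y Z : VField E M, IsSmooth X → IsSmooth Y → IsSmooth Z → ∀ x : M,
    der X (pair g Y Z) x = pair g (nabla D X Y) Z x + pair g Y (nabla D X Z) x

/-- A metric connection is locally homogeneous (an Ambrose-Singer connection) if its torsion and
its curvature are parallel. -/
structure IsLocallyHomogeneous (g : Metric E M) (D : Connection E M) : Prop where
  metric : IsMetricConnection g D
  torsion : HasParallelTorsion D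
  curvature : HasParallelCurvature D

/-- The covariant derivative `(D_X J) Y` of a field `J` of endomorphisms. -/
def nablaEnd (D : Connection E M) (J : EndField E M) (X Y : VField E M) : VField E M :=
  nabla D X (J.app Y) - J.app (nabla D X Y)

/-- `J` is an almost complex structure that is orthogonal for `g`. -/
structure IsAlmostHermitian (g : Metric E M) (J : EndField E M) : Prop where
  sq : ∀ (x : M) (v : TangentSpace 𝓘(ℝ, E) x), J.at' x (J.at' x v) = -v
  orth : ∀ (x : M) (v w : TangentSpace 𝓘(ℝ, E) x),
    g.inner x (J.at' x v) (J.at' x w) = g.inner x v w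

/-- `(g, J)` is Kähler: almost Hermitian with `∇ J = 0`. -/
structure IsKahler (g : Metric E M) (J : EndField E M) : Prop extends IsAlmostHermitian g J where
  parallel : ∀ X Y : VField E M, IsSmooth X → IsSmooth Y → nablaEnd (leviCivita g) J X Y = 0

/-- `(g, J)` is nearly Kähler: almost Hermitian with `(∇_X J) X = 0`. -/
structure IsNearlyKahler (g : Metric E M) (J : EndField E M) : Prop
    extends IsAlmostHermitian g J where
  nearly : ∀ X : VField E M, IsSmooth X → nablaEnd (leviCivita g) J X X = 0

/-- `(g, J)` is locally Hermitian symmetric: Kähler and locally symmetric, i.e. the Riemann curvature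
tensor satisfies `∇ R = 0`. -/
structure IsLocallyHermitianSymmetric (g : Metric E M) (J : EndField E M) : Prop
    extends IsKahler g J where
  symmetric : HasParallelCurvature (leviCivita g)

/-- The canonical Hermitian connection `D_X Y = ∇_X Y - (1/2) J (∇_X J) Y` of `(g, J)`, with `∇` the
Levi-Civita connection of `g`. -/
def canonicalHermitian (g : Metric E M) (J : EndField E M) : Connection E M where
  toFun Y x := leviCivita g Y x
    - (1 / 2 : ℝ) • (J.at' x ∘L (leviCivita g (J.app Y) x - J.at' x ∘L leviCivita g Y x))
  isCovariantDerivativeOnUniv :=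
    { add := by
        intro Y Y' x hY hY' _
        have h : J.app (Y + Y') = J.app Y + J.app Y' := by
          ext y; simp [EndField.app]
        rw [h, (leviCivita g).isCovariantDerivativeOn.add hY hY',
          (leviCivita g).isCovariantDerivativeOn.add (J.app_diffAt hY) (J.app_diffAt hY')]
        ext v
        simp
        module
      leibniz := by
        intro Y f x hY hf _
        have h : J.app (f • Y) = f • J.app Y := by
          ext y; simp [EndField.app]
        rw [h, (leviCivita g).isCovariantDerivativeOn.leibniz hY hf,
          (leviCivita g).isCovariantDerivativeOn.leibniz (J.app_diffAt hY) hf]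
        ext v
        simp [EndField.app]
        module }

/-- A smooth distribution on `M`, i.e. a smooth family of subspaces `fiber x` of the tangent spaces.
Smoothness is the smoothness of the field `proj` of `g`-orthogonal projections onto the fibers. -/
structure SmoothDistribution (g : Metric E M) where
  /-- the subspaces that form the distribution -/
  fiber : (x : M) → Submodule ℝ (TangentSpace 𝓘(ℝ, E) x)
  /-- the orthogonal projections onto these subspaces -/
  proj : EndField E M
  proj_mem : ∀ (x : M) (v : TangentSpace 𝓘(ℝ, E) x), proj.at' x v ∈ fiber x
  proj_orth : ∀ (x : M) (v : TangentSpace 𝓘(ℝ, E) x), ∀ w ∈ fiber x,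
    g.inner x (v - proj.at' x v) w = 0

namespace SmoothDistribution

variable {g : Metric E M} (V : SmoothDistribution g)

/-- Vector fields tangent to the distribution (vertical vector fields). -/
def Vertical (X : VField E M) : Prop := ∀ x, X x ∈ V.fiber x

/-- Vector fields orthogonal to the distribution (horizontal vector fields). -/
def Horizontal (X : VField E M) : Prop := ∀ x, ∀ w ∈ V.fiber x, g.inner x (X x) w = 0

/-- The distribution is the tangent distribution of a foliation, i.e. (Frobenius) it is involutive. -/
def IsFoliation : Prop :=
  ∀ X Y : VField E M, IsSmooth X → IsSmooth Y → V.Vertical X → V.Vertical Y →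
    V.Vertical (bracket X Y)

/-- The leaves are complex submanifolds: `J` preserves their tangent spaces. -/
def IsComplex (J : EndField E M) : Prop :=
  ∀ (x : M), ∀ v ∈ V.fiber x, J.at' x v ∈ V.fiber x

/-- The foliation is Riemannian: `(L_U g)(X, Y) = 0` for `U` vertical and `X`, `Y` horizontal. -/
def IsRiemannian : Prop :=
  ∀ U X Y : VField E M, IsSmooth U → IsSmooth X → IsSmooth Y →
    V.Vertical U → V.Horizontal X → V.Horizontal Y → ∀ x : M,
      der U (pair g X Y) x - pair g (bracket U X) Y x - pair g X (bracket U Y) x = 0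

/-- The leaves are totally geodesic: `∇_U W` is vertical for `U`, `W` vertical. -/
def IsTotallyGeodesic : Prop :=
  ∀ U W : VField E M, IsSmooth U → IsSmooth W → V.Vertical U → V.Vertical W →
    V.Vertical (nabla (leviCivita g) U W)

theorem proj_of_mem {x : M} {v : TangentSpace 𝓘(ℝ, E) x} (hv : v ∈ V.fiber x) :
    V.proj.at' x v = v := by
  by_contra hne
  have h1 : v - V.proj.at' x v ∈ V.fiber x := (V.fiber x).sub_mem hv (V.proj_mem x v)
  have h2 : v - V.proj.at' x v ≠ 0 := fun h ↦ hne (sub_eq_zero.1 h).symm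
  exact (g.pos x _ h2).ne' (V.proj_orth x v _ h1)

theorem proj_proj (x : M) (v : TangentSpace 𝓘(ℝ, E) x) :
    V.proj.at' x (V.proj.at' x v) = V.proj.at' x v :=
  V.proj_of_mem (V.proj_mem x v)

theorem inner_proj_proj (x : M) (v w : TangentSpace 𝓘(ℝ, E) x) :
    g.inner x (V.proj.at' x v) (V.proj.at' x w) = g.inner x (V.proj.at' x v) w := by
  have h := V.proj_orth x w _ (V.proj_mem x v)
  rw [map_sub, sub_apply, sub_eq_zero] at h
  rw [g.symm x _ w, h, g.symm]

/-- The Bott connection `D_X Y = (∇_X Y_V)_V + (∇_X Y_H)_H`, where the indices `V` and `H` are the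
components tangent and orthogonal to the distribution. -/
def bott : Connection E M where
  toFun Y x := V.proj.at' x ∘L leviCivita g (V.proj.app Y) x
    + (ContinuousLinearMap.id ℝ _ - V.proj.at' x) ∘L leviCivita g (Y - V.proj.app Y) x
  isCovariantDerivativeOnUniv :=
    { add := by
        intro Y Y' x hY hY' _
        have h : V.proj.app (Y + Y') = V.proj.app Y + V.proj.app Y' := by
          ext y; simp [EndField.app]
        have h' : Y + Y' - (V.proj.app Y + V.proj.app Y')
            = (Y - V.proj.app Y) + (Y' - V.proj.app Y') := by abel
        have hP := V.proj.app_diffAt hY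
        have hP' := V.proj.app_diffAt hY'
        have hQ : DiffAt (Y - V.proj.app Y) x := mdifferentiableAt_sub_section hY hP
        have hQ' : DiffAt (Y' - V.proj.app Y') x := mdifferentiableAt_sub_section hY' hP'
        rw [h, h', (leviCivita g).isCovariantDerivativeOn.add hP hP',
          (leviCivita g).isCovariantDerivativeOn.add hQ hQ']
        ext v
        simp
        abel
      leibniz := by
        intro Y f x hY hf _
        have h : V.proj.app (f • Y) = f • V.proj.app Y := by
          ext y; simp [EndField.app]
        have h' : f • Y - f • V.proj.app Y = f • (Y - V.proj.app Y) := by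
          rw [smul_sub]
        have hP := V.proj.app_diffAt hY
        have hQ : DiffAt (Y - V.proj.app Y) x := mdifferentiableAt_sub_section hY hP
        rw [h, h', (leviCivita g).isCovariantDerivativeOn.leibniz hP hf,
          (leviCivita g).isCovariantDerivativeOn.leibniz hQ hf]
        ext v
        simp [EndField.app, V.proj_proj]
        module }

theorem inner_compl_proj (x : M) (v w : TangentSpace 𝓘(ℝ, E) x) :
    g.inner x (v - V.proj.at' x v) (w - V.proj.at' x w) = g.inner x (v - V.proj.at' x v) w := by
  rw [map_sub, V.proj_orth x v _ (V.proj_mem x w), sub_zero]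

/-- The bilinear form `t g` on the distribution, `g` on its orthogonal complement, with the two
orthogonal: since the projections are self-adjoint, `t g(v_V, w) + g(v_H, w)` is
`t g(v_V, w_V) + g(v_H, w_H)`, see `variation_inner`. -/
def variationForm (t : ℝ) (x : M) :
    TangentSpace 𝓘(ℝ, E) x →L[ℝ] TangentSpace 𝓘(ℝ, E) x →L[ℝ] ℝ :=
  t • (g.inner x ∘L V.proj.at' x)
    + g.inner x ∘L (ContinuousLinearMap.id ℝ (TangentSpace 𝓘(ℝ, E) x) - V.proj.at' x)

theorem variationForm_apply (t : ℝ) (x : M) (v w : TangentSpace 𝓘(ℝ, E) x) :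
    V.variationForm t x v w = t * g.inner x (V.proj.at' x v) (V.proj.at' x w)
      + g.inner x (v - V.proj.at' x v) (w - V.proj.at' x w) := by
  rw [inner_proj_proj, inner_compl_proj]
  rfl

theorem inner_self_eq (x : M) (v : TangentSpace 𝓘(ℝ, E) x) :
    g.inner x v v = g.inner x (V.proj.at' x v) (V.proj.at' x v)
      + g.inner x (v - V.proj.at' x v) (v - V.proj.at' x v) := by
  rw [inner_proj_proj, inner_compl_proj, ← add_apply, ← map_add, add_sub_cancel]

theorem inner_self_nonneg (g : Metric E M) (x : M) (v : TangentSpace 𝓘(ℝ, E) x) :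
    0 ≤ g.inner x v v := by
  by_cases h : v = 0
  · simp [h]
  · exact (g.pos x v h).le

theorem le_variationForm (t : ℝ) (x : M) (v : TangentSpace 𝓘(ℝ, E) x) :
    min t 1 * g.inner x v v ≤ V.variationForm t x v v := by
  rw [variationForm_apply, V.inner_self_eq x v, mul_add]
  have h1 := inner_self_nonneg g x (V.proj.at' x v)
  have h2 := inner_self_nonneg g x (v - V.proj.at' x v)
  have h3 := mul_le_mul_of_nonneg_right (min_le_left t 1) h1
  have h4 := mul_le_mul_of_nonneg_right (min_le_right t 1) h2
  linarith

/-- The canonical variation `g_t` of the metric: `t g` on the distribution, `g` on its orthogonal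
complement, and the two remain orthogonal. -/
def variation (t : ℝ) (ht : 0 < t) : Metric E M where
  inner := V.variationForm t
  symm x v w := by
    rw [variationForm_apply, variationForm_apply, g.symm x (V.proj.at' x v),
      g.symm x (v - V.proj.at' x v)]
  pos x v hv := lt_of_lt_of_le (mul_pos (lt_min ht one_pos) (g.pos x v hv))
    (V.le_variationForm t x v)
  isVonNBounded x := by
    have hm : 0 < min t 1 := lt_min ht one_pos
    have h := (g.isVonNBounded x).image
      ((Real.sqrt (min t 1))⁻¹ • ContinuousLinearMap.id ℝ (TangentSpace 𝓘(ℝ, E) x))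
    refine Bornology.IsVonNBounded.subset ?_ h
    intro v hv
    refine (Set.mem_image _ _ _).2 ⟨Real.sqrt (min t 1) • v, ?_, ?_⟩
    · have h1 := V.le_variationForm t x v
      have h2 : V.variationForm t x v v < 1 := hv
      simp only [Set.mem_ofPred_eq, map_smul, smul_apply, smul_eq_mul]
      rw [← mul_assoc, Real.mul_self_sqrt hm.le]
      linarith
    · simp [smul_smul, mul_inv_cancel₀ (Real.sqrt_pos.2 hm).ne']
  contMDiff := by
    have hP := clm_comp_smooth V.proj.smooth g.contMDiff
    have h1 := (hP.const_smul_section (a := t)).add_section (g.contMDiff.sub_section hP)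
    convert h1 using 2 with x
    congr 1
    ext v w
    simp [variationForm]

theorem variation_inner (t : ℝ) (ht : 0 < t) (x : M) (v w : TangentSpace 𝓘(ℝ, E) x) :
    (V.variation t ht).inner x v w = t * g.inner x (V.proj.at' x v) (V.proj.at' x w)
      + g.inner x (v - V.proj.at' x v) (w - V.proj.at' x w) :=
  V.variationForm_apply t x v w

/-- The metric `g^NK`: the canonical variation with parameter `t = 1/2`. -/
def nkMetric : Metric E M := V.variation (1 / 2) (by norm_num)

/-- The almost complex structure of `g^NK`: `-J` on the distribution and `J` on its orthogonal
complement. -/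
def nkStructure (J : EndField E M) : EndField E M where
  at' x := J.at' x ∘L (ContinuousLinearMap.id ℝ (TangentSpace 𝓘(ℝ, E) x) - V.proj.at' x)
    - J.at' x ∘L V.proj.at' x
  smooth := by
    have hP := clm_comp_smooth V.proj.smooth J.smooth
    have h1 := (J.smooth.sub_section hP).sub_section hP
    convert h1 using 2 with x
    congr 1
    ext v
    simp

end SmoothDistribution

end LeviCivita

end RiemFol

end

open RiemFol

/-! Write `∇ = D + B` with `D` the Bott connection. Each `B_X` exchanges vertical and horizontal
fields, is skew for `g` and commutes with `J`. Totally geodesic leaves give `B_U = 0` for `U`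
vertical, and the Riemannian condition gives `B_X Y = -B_Y X` for `X`, `Y` horizontal, so `B` is
essentially O'Neill's integrability tensor.

The core is that `B` is `D`-parallel (`DB_eq_zero`). O'Neill's formulas express components of the
curvature `R` through `DB` and `B`. Bianchi, pair symmetry and the Kähler identity `R(JX, JY) = R(X,
Y)` then force each component of `DB` to equal its own negative (`met_DB_of_vertical`,
`met_DB_of_horizontal`).

Hence the torsion `T(X, Y) = B_Y X - B_X Y` of `D` is parallel, and the curvature of `D` is `R` plus
terms quadratic in `B`. The reflection `S` in the leaves commutes with `D`, anticommutes with `B_W`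
and preserves `R` (`R_S`). So `D_W - B_W` annihilates `R` together with `∇_W = D_W + B_W`, and the
average `D` does too (`D_R`).

For `t = 1/2` the tensor `T` is totally skew for `g^NK` (`nkMet_B_sub_B_skew`), so `D - T/2` is
metric and torsion free and equals `∇^NK` by uniqueness (`nab_unique`). Since `T` anticommutes with
the new structure `J'` (`B_sub_B_nkJ`), one finds `(∇^NK_X J') Y = J' T(X, Y)`. This vanishes for `X
= Y`, and the correction in the canonical Hermitian connection turns `D - T/2` back into `D`.

The argument is real multilinear algebra on the space of smooth fields; analysis only has to show
that the Levi-Civita connection acts there and has its usual properties. -/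

noncomputable section

namespace RiemFol

/-! ### Smooth vector fields: closure properties and brackets -/

section SmoothFields

variable {E : Type*} [NormedAddCommGroup E] [NormedSpace ℝ E] [CompleteSpace E]
  {M : Type*} [TopologicalSpace M] [ChartedSpace E M] [IsManifold 𝓘(ℝ, E) ∞ M]

/-- Smooth real functions on `M`. -/
abbrev IsSmoothFun (E : Type*) [NormedAddCommGroup E] [NormedSpace ℝ E]
    {M : Type*} [TopologicalSpace M] [ChartedSpace E M] (f : M → ℝ) : Prop :=
  ContMDiff 𝓘(ℝ, E) 𝓘(ℝ) ∞ f

theorem IsSmooth.diffAt {X : VField E M} (hX : IsSmooth X) (x : M) : DiffAt X x :=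
  (hX x).mdifferentiableAt (by simp)

theorem IsSmoothFun.mdiffAt {f : M → ℝ} (hf : IsSmoothFun E f) (x : M) :
    MDifferentiableAt 𝓘(ℝ, E) 𝓘(ℝ) f x :=
  (hf x).mdifferentiableAt (by simp)

theorem IsSmooth.add {X Y : VField E M} (hX : IsSmooth X) (hY : IsSmooth Y) : IsSmooth (X + Y) :=
  ContMDiff.add_section hX hY

theorem IsSmooth.sub {X Y : VField E M} (hX : IsSmooth X) (hY : IsSmooth Y) : IsSmooth (X - Y) :=
  ContMDiff.sub_section hX hY

theorem IsSmooth.const_smul {X : VField E M} (c : ℝ) (hX : IsSmooth X) : IsSmooth (c • X) :=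
  ContMDiff.const_smul_section hX

theorem IsSmooth.smul {f : M → ℝ} {X : VField E M} (hf : IsSmoothFun E f) (hX : IsSmooth X) :
    IsSmooth (f • X) :=
  ContMDiff.smul_section hf hX

theorem isSmooth_zero : IsSmooth (0 : VField E M) :=
  contMDiff_zeroSection ℝ (TangentSpace 𝓘(ℝ, E) : M → Type _)

theorem IsSmooth.app (A : EndField E M) {X : VField E M} (hX : IsSmooth X) : IsSmooth (A.app X) :=
  ContMDiff.clm_bundle_apply (F₁ := E) (F₂ := E) A.smooth hX

theorem IsSmooth.pair (g : Metric E M) {X Y : VField E M} (hX : IsSmooth X) (hY : IsSmooth Y) :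
    IsSmoothFun E (pair g X Y) := by
  have : ContMDiff 𝓘(ℝ, E) (𝓘(ℝ, E).prod 𝓘(ℝ)) ∞
      (fun m ↦ TotalSpace.mk' ℝ (E := Bundle.Trivial M ℝ) m (g.inner m (X m) (Y m))) :=
    ContMDiff.clm_bundle_apply₂ (F₁ := E) (F₂ := E) g.contMDiff hX hY
  intro x
  exact (contMDiffAt_totalSpace.1 (this x)).2

theorem IsSmooth.bracket {X Y : VField E M} (hX : IsSmooth X) (hY : IsSmooth Y) :
    IsSmooth (bracket X Y) := by
  have : IsManifold 𝓘(ℝ, E) (((⊤ : ℕ∞) : WithTop ℕ∞) + 1) M :=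
    inferInstanceAs (IsManifold 𝓘(ℝ, E) ∞ M)
  have : IsManifold 𝓘(ℝ, E) (minSmoothness ℝ 2) M := by
    simp only [minSmoothness_of_isRCLikeNormedField]; infer_instance
  intro x
  exact ContMDiffAt.mlieBracket_vectorField (m := ⊤) (n := ⊤) (hX x) (hY x) (by simp)

/-- `X f` is the fibre component of the tangent map of `f` composed with the section `X`. -/
theorem IsSmoothFun.der {f : M → ℝ} {X : VField E M} (hX : IsSmooth X) (hf : IsSmoothFun E f) :
    IsSmoothFun E (der X f) := by
  have h1 : ContMDiff 𝓘(ℝ, E).tangent 𝓘(ℝ).tangent ∞ (tangentMap 𝓘(ℝ, E) 𝓘(ℝ) f) :=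
    ContMDiff.contMDiff_tangentMap hf (by simp)
  have h2 := (contMDiff_snd_tangentBundle_modelSpace ℝ 𝓘(ℝ) (n := ∞)).comp (h1.comp hX)
  exact h2

theorem bracket_jacobi {X Y Z : VField E M} (hX : IsSmooth X) (hY : IsSmooth Y)
    (hZ : IsSmooth Z) :
    bracket X (bracket Y Z) = bracket (bracket X Y) Z + bracket Y (bracket X Z) := by
  have : IsManifold 𝓘(ℝ, E) (minSmoothness ℝ 3) M := by
    simp only [minSmoothness_of_isRCLikeNormedField]; infer_instance
  have h : minSmoothness ℝ 2 ≤ (∞ : WithTop ℕ∞) := by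
    simp only [minSmoothness_of_isRCLikeNormedField]; exact WithTop.coe_le_coe.2 le_top
  exact VectorField.leibniz_identity_mlieBracket (hX.of_le h) (hY.of_le h) (hZ.of_le h)

theorem bracket_swap (X Y : VField E M) : bracket X Y = -bracket Y X := by
  exact VectorField.mlieBracket_swap

theorem bracket_smul {f : M → ℝ} {X Y : VField E M} (hf : IsSmoothFun E f) (hY : IsSmooth Y) :
    bracket X (f • Y) = der X f • Y + f • bracket X Y := by
  ext x
  exact bracket_smul_right X (hf.mdiffAt x) (hY.diffAt x)

theorem bracket_add {X Y Y' : VField E M} (hY : IsSmooth Y) (hY' : IsSmooth Y') :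
    bracket X (Y + Y') = bracket X Y + bracket X Y' := by
  ext x
  exact bracket_add_right X (hY.diffAt x) (hY'.diffAt x)

/-! ### Global fields from bump functions, and smoothness criteria -/

section Bump

variable [FiniteDimensional ℝ E] [T2Space M]

/-- A constant vector in a chart at `x` is locally the value of a global smooth vector field. -/
theorem exists_isSmooth_eventuallyEq_symmL (x : M) (v : E) :
    ∃ X : VField E M, IsSmooth X ∧
      ∀ᶠ y in 𝓝 x, X y = (trivializationAt E (TangentSpace 𝓘(ℝ, E)) x).symmL ℝ y v := by
  set e := trivializationAt E (TangentSpace 𝓘(ℝ, E) : M → Type _) x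
  obtain ⟨ρ⟩ : Nonempty (SmoothBumpFunction 𝓘(ℝ, E) x) := inferInstance
  have hs : ContMDiffOn 𝓘(ℝ, E) (𝓘(ℝ, E).prod 𝓘(ℝ, E)) ∞
      (fun y ↦ TotalSpace.mk' E y (e.symmL ℝ y v)) e.baseSet := by
    intro y hy
    have hv : ContMDiffAt 𝓘(ℝ, E) (𝓘(ℝ, E).prod 𝓘(ℝ, E)) ∞
      (fun y : M ↦ TotalSpace.mk' E (E := Bundle.Trivial M E) y v) y :=
      contMDiffAt_totalSpace.2 ⟨contMDiffAt_id, contMDiffAt_const⟩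
    exact (ContMDiffAt.clm_bundle_apply (F₁ := E) (F₂ := E) (E₁ := Bundle.Trivial M E)
      (e.contMDiffAt_symmL (n := ∞) (IB := 𝓘(ℝ, E)) hy) hv).contMDiffWithinAt
  have hsub : tsupport ρ ⊆ e.baseSet := ρ.tsupport_subset_chartAt_source
  refine ⟨⇑ρ • fun y ↦ e.symmL ℝ y v,
    ContMDiffOn.smul_section_of_tsupport ρ.contMDiff.contMDiffOn e.open_baseSet hsub hs, ?_⟩
  filter_upwards [ρ.eventuallyEq_one] with y hy
  simp [hy, e]

theorem exists_isSmooth_apply_eq (x : M) (v : TangentSpace 𝓘(ℝ, E) x) :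
    ∃ X : VField E M, IsSmooth X ∧ X x = v := by
  set e := trivializationAt E (TangentSpace 𝓘(ℝ, E) : M → Type _) x
  obtain ⟨X, hX, h⟩ := exists_isSmooth_eventuallyEq_symmL x (e.continuousLinearMapAt ℝ x v)
  refine ⟨X, hX, ?_⟩
  rw [h.self_of_nhds]
  exact e.symmL_continuousLinearMapAt (FiberBundle.mem_baseSet_trivializationAt' x) v

/-- A field of endomorphisms or forms depends smoothly on the point as soon as its values do. -/
theorem contMDiffAt_clm_of_apply {F : Type*} [NormedAddCommGroup F] [NormedSpace ℝ F]
    {f : M → E →L[ℝ] F} {x : M} (h : ∀ v, ContMDiffAt 𝓘(ℝ, E) 𝓘(ℝ, F) ∞ (fun y ↦ f y v) x) :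
    ContMDiffAt 𝓘(ℝ, E) 𝓘(ℝ, E →L[ℝ] F) ∞ f x := by
  set b := Module.finBasis ℝ E
  -- In a finite basis, `f y` is the sum of the coordinate forms tensored with the values `f y (b
  -- i)`.
  have hf : f = fun y ↦ ∑ i, ContinuousLinearMap.smulRightL ℝ E F
      (LinearMap.toContinuousLinearMap (b.coord i)) (f y (b i)) := by
    ext y v
    conv_lhs => rw [← b.sum_repr v]
    simp [ContinuousLinearMap.smulRightL, -Module.Basis.sum_repr]
  rw [hf]
  exact ContMDiffAt.sum fun i _ ↦
    (ContinuousLinearMap.contMDiff _).contMDiffAt.comp x (h (b i))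

theorem isInvertible_of_pos {B : E →L[ℝ] E →L[ℝ] ℝ} (hB : ∀ v, v ≠ 0 → 0 < B v v) :
    B.IsInvertible := by
  let c : (E →ₗ[ℝ] ℝ) ≃ₗ[ℝ] (E →L[ℝ] ℝ) := LinearMap.toContinuousLinearMap
  have hinj : Function.Injective B.toLinearMap := by
    rw [injective_iff_map_eq_zero]
    intro v hv
    by_contra hne
    have h0 : B v = 0 := hv
    have h1 := hB v hne
    simp [h0] at h1
  have hd : Module.finrank ℝ E = Module.finrank ℝ (E →L[ℝ] ℝ) := by
    rw [← c.finrank_eq]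
    exact (Subspace.dual_finrank_eq (K := ℝ) (V := E)).symm
  exact ⟨(LinearMap.linearEquivOfInjective B.toLinearMap hinj hd).toContinuousLinearEquiv,
    by ext v w; rfl⟩

/-- A vector field is smooth as soon as its products with all smooth vector fields are. -/
theorem isSmooth_of_pair (g : Metric E M) {W : VField E M}
    (h : ∀ Z, IsSmooth Z → IsSmoothFun E (pair g W Z)) : IsSmooth W := by
  intro x
  set e := trivializationAt E (TangentSpace 𝓘(ℝ, E) : M → Type _) x with he
  have hx : x ∈ e.baseSet := FiberBundle.mem_baseSet_trivializationAt' x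
  refine (e.contMDiffAt_section_iff hx).2 ?_
  -- In the trivialization, `W` solves the linear equation `G W = α` with `G` the Gram form. Both
  -- `G` and `α` are smooth by testing on fields that are constant in the chart, and inversion is
  -- smooth at invertible maps.
  let α : M → E →L[ℝ] ℝ := fun y ↦ g.inner y (W y) ∘L e.symmL ℝ y
  let s : M → E →L[ℝ] E := fun y ↦ e.symmL ℝ y
  let q : M → E →L[ℝ] E →L[ℝ] ℝ := fun y ↦ g.inner y
  let G : M → E →L[ℝ] E →L[ℝ] ℝ := fun y ↦ (q y).bilinearComp (s y) (s y)
  have hGapp (y : M) (v w : E) : G y v w = g.inner y (e.symmL ℝ y v) (e.symmL ℝ y w) := rfl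
  have hα : ContMDiffAt 𝓘(ℝ, E) 𝓘(ℝ, E →L[ℝ] ℝ) ∞ α x := by
    refine contMDiffAt_clm_of_apply fun v ↦ ?_
    obtain ⟨Z, hZ, hZe⟩ := exists_isSmooth_eventuallyEq_symmL x v
    refine (h Z hZ x).congr_of_eventuallyEq ?_
    filter_upwards [hZe] with y hy
    simp only [pair, hy]
    rfl
  have hG : ContMDiffAt 𝓘(ℝ, E) 𝓘(ℝ, E →L[ℝ] E →L[ℝ] ℝ) ∞ G x := by
    refine contMDiffAt_clm_of_apply fun v ↦ contMDiffAt_clm_of_apply fun w ↦ ?_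
    obtain ⟨X, hX, hXe⟩ := exists_isSmooth_eventuallyEq_symmL x v
    obtain ⟨Z, hZ, hZe⟩ := exists_isSmooth_eventuallyEq_symmL x w
    refine (hX.pair g hZ x).congr_of_eventuallyEq ?_
    filter_upwards [hXe, hZe] with y hy hy'
    simp only [pair, hy, hy', hGapp, he]
  have hinv (y : M) (hy : y ∈ e.baseSet) : (G y).IsInvertible := by
    refine isInvertible_of_pos fun v hv ↦ g.pos y _ fun h0 ↦ hv ?_
    have h1 := e.continuousLinearMapAt_symmL (R := ℝ) hy v
    change e.symmL ℝ y v = 0 at h0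
    rw [h0, map_zero] at h1
    exact h1.symm
  have hGW (y : M) (hy : y ∈ e.baseSet) : G y (e ⟨y, W y⟩).2 = α y := by
    have h1 := e.symmL_continuousLinearMapAt (R := ℝ) hy (W y)
    rw [e.continuousLinearMapAt_apply ℝ, e.linearMapAt_apply (R := ℝ), if_pos hy] at h1
    ext v
    rw [hGapp, h1]
    rfl
  have hsm : ContMDiffAt 𝓘(ℝ, E) 𝓘(ℝ, E) ∞ (fun y ↦ (G y).inverse (α y)) x :=
    ((hinv x hx).contDiffAt_map_inverse.contMDiffAt.comp x hG).clm_apply hα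
  refine hsm.congr_of_eventuallyEq ?_
  filter_upwards [e.open_baseSet.mem_nhds hx] with y hy
  obtain ⟨T, hT⟩ := hinv y hy
  rw [← hGW y hy, ← hT]
  simp

/-- Expand the Jacobi identity for `X`, `Y`, `f Z` by the Leibniz rule and subtract `f` times the
one for `X`, `Y`, `Z`. What remains is the difference of the two sides times `Z`, where `Z x ≠ 0`.
-/
theorem der_bracket {X Y : VField E M} {f : M → ℝ} (hX : IsSmooth X) (hY : IsSmooth Y)
    (hf : IsSmoothFun E f) : der (bracket X Y) f = der X (der Y f) - der Y (der X f) := by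
  ext x
  -- In a zero tangent space no `Z` with `Z x ≠ 0` exists, but there both sides vanish trivially.
  by_cases hE : bracket X Y x = 0 ∧ X x = 0 ∧ Y x = 0
  · simp [der, hE]
  · obtain ⟨v, hv⟩ : ∃ v : TangentSpace 𝓘(ℝ, E) x, v ≠ 0 := by
      by_contra! h
      exact hE ⟨h _, h _, h _⟩
    obtain ⟨Z, hZ, rfl⟩ := exists_isSmooth_apply_eq x v
    have hXf := hf.der hX
    have hYf := hf.der hY
    have hJ := congrFun (bracket_jacobi hX hY (IsSmooth.smul hf hZ)) x
    have hJ' := congrFun (bracket_jacobi hX hY hZ) x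
    simp only [bracket_smul hf hZ, bracket_add (hZ.smul hYf) ((hY.bracket hZ).smul hf),
      bracket_add (hZ.smul hXf) ((hX.bracket hZ).smul hf), bracket_smul hYf hZ,
      bracket_smul hXf hZ, bracket_smul hf (hX.bracket hZ), bracket_smul hf (hY.bracket hZ),
      Pi.add_apply, Pi.smul_apply'] at hJ hJ'
    rw [hJ'] at hJ
    have h0 : (der (bracket X Y) f x - (der X (der Y f) x - der Y (der X f) x)) • Z x = 0 := by
      rw [← neg_eq_zero, ← sub_eq_zero.2 hJ]
      module
    exact sub_eq_zero.1 ((smul_eq_zero.1 h0).resolve_right hv)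

end Bump

/-! ### The Levi-Civita connection on smooth fields -/

section LeviCivita

variable [FiniteDimensional ℝ E]

/-- The Koszul formula; from here on the connection is used only through it. -/
theorem inner_leviCivita (g : Metric E M) {X Y Z : VField E M} {x : M}
    (hX : DiffAt X x) (hY : DiffAt Y x) (hZ : DiffAt Z x) :
    pair g (nabla (leviCivita g) X Y) Z x = 1 / 2 * koszul g X Y Z x := by
  have hinv (α : TangentSpace 𝓘(ℝ, E) x →L[ℝ] ℝ) : g.inner x ((g.inner x).inverse α) = α := by
    obtain ⟨e, he⟩ := inner_isInvertible g x
    rw [← he]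
    simp
  have h : nabla (leviCivita g) X Y x
      = (1 / 2 : ℝ) • (g.inner x).inverse (koszulForm g Y x hY (X x)) := by
    change (open Classical in if hY : DiffAt Y x then
      (1 / 2 : ℝ) • (g.inner x).inverse ∘L koszulForm g Y x hY else 0) (X x) = _
    rw [dif_pos hY]
    rfl
  rw [pair, h, map_smul, hinv, smul_apply, koszulForm_apply g hX hY hZ, smul_eq_mul]

theorem IsSmooth.koszul (g : Metric E M) {X Y Z : VField E M}
    (hX : IsSmooth X) (hY : IsSmooth Y) (hZ : IsSmooth Z) : IsSmoothFun E (koszul g X Y Z) :=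
  (((((hY.pair g hZ).der hX).add ((hX.pair g hZ).der hY)).sub ((hX.pair g hY).der hZ)).add
    ((hX.bracket hY).pair g hZ)).sub ((hX.bracket hZ).pair g hY) |>.sub
    ((hY.bracket hZ).pair g hX)

theorem pair_neg_left (g : Metric E M) (X Y : VField E M) : pair g (-X) Y = -pair g X Y := by
  ext x; simp [pair]

theorem pair_sub_left (g : Metric E M) (X X' Y : VField E M) :
    pair g (X - X') Y = pair g X Y - pair g X' Y := by
  ext x; simp [pair]

theorem eq_of_pair (g : Metric E M) {X Y : VField E M} {x : M}
    (h : pair g (X - Y) (X - Y) x = 0) : X x = Y x := by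
  by_contra hne
  exact (g.pos x _ (sub_ne_zero.2 hne)).ne' h

theorem leviCivita_metric (g : Metric E M) : IsMetricConnection g (leviCivita g) := by
  intro X Y Z hX hY hZ x
  rw [pair_comm g Y (nabla _ X Z), inner_leviCivita g (hX.diffAt x) (hY.diffAt x) (hZ.diffAt x),
    inner_leviCivita g (hX.diffAt x) (hZ.diffAt x) (hY.diffAt x)]
  simp only [RiemFol.koszul, bracket_swap Z Y, pair_neg_left, pair_comm g Z Y, Pi.neg_apply]
  ring

variable [T2Space M]

/-- The Koszul expression is smooth in the base point, and products with smooth test fields detect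
smoothness. -/
theorem IsSmooth.leviCivita (g : Metric E M) {X Y : VField E M} (hX : IsSmooth X)
    (hY : IsSmooth Y) : IsSmooth (nabla (leviCivita g) X Y) := by
  refine isSmooth_of_pair g fun Z hZ ↦ ?_
  have h : RiemFol.pair g (nabla (RiemFol.leviCivita g) X Y) Z
      = fun x ↦ 1 / 2 * RiemFol.koszul g X Y Z x := by
    ext x
    exact inner_leviCivita g (hX.diffAt x) (hY.diffAt x) (hZ.diffAt x)
  rw [h]
  exact contMDiff_const.mul (IsSmooth.koszul g hX hY hZ)

theorem leviCivita_torsion_free (g : Metric E M) {X Y : VField E M} (hX : IsSmooth X)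
    (hY : IsSmooth Y) :
    nabla (leviCivita g) X Y - nabla (leviCivita g) Y X = bracket X Y := by
  ext x
  refine eq_of_pair g ?_
  -- The defect itself is a legitimate test field, being smooth; its square norm vanishes by Koszul.
  set Z := nabla (leviCivita g) X Y - nabla (leviCivita g) Y X - bracket X Y
  have hZ : IsSmooth Z :=
    ((IsSmooth.leviCivita g hX hY).sub (IsSmooth.leviCivita g hY hX)).sub (hX.bracket hY)
  rw [pair_sub_left, pair_sub_left, Pi.sub_apply, Pi.sub_apply,
    inner_leviCivita g (hX.diffAt x) (hY.diffAt x) (hZ.diffAt x),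
    inner_leviCivita g (hY.diffAt x) (hX.diffAt x) (hZ.diffAt x)]
  simp only [RiemFol.koszul, bracket_swap Y X, pair_neg_left, pair_comm g Y X, Pi.neg_apply]
  ring

end LeviCivita

end SmoothFields

/-! ### Metric connections and curvature symmetries, algebraically -/

section Algebra

variable {L C : Type*} [AddCommGroup L] [Module ℝ L] [AddCommGroup C] [Module ℝ C]

/-- The algebraic structure that a Riemannian metric with its Levi-Civita connection induces on the
space `L` of smooth vector fields and the space `C` of smooth functions. -/
structure MetricLieAlgebra (L C : Type*) [AddCommGroup L] [Module ℝ L] [AddCommGroup C]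
    [Module ℝ C] where
  /-- the metric -/
  met : L →ₗ[ℝ] L →ₗ[ℝ] C
  /-- the derivative of functions along vector fields -/
  der : L →ₗ[ℝ] C →ₗ[ℝ] C
  /-- the Lie bracket -/
  br : L → L → L
  /-- the Levi-Civita connection -/
  nab : L →ₗ[ℝ] L →ₗ[ℝ] L
  met_comm : ∀ X Y, met X Y = met Y X
  eq_zero_of_met_self : ∀ X, met X X = 0 → X = 0
  der_met : ∀ X Y Z, der X (met Y Z) = met (nab X Y) Z + met Y (nab X Z)
  nab_sub_nab : ∀ X Y, nab X Y - nab Y X = br X Y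
  der_br : ∀ X Y f, der (br X Y) f = der X (der Y f) - der Y (der X f)
  jacobi : ∀ X Y Z, br X (br Y Z) = br (br X Y) Z + br Y (br X Z)

namespace MetricLieAlgebra

variable (K : MetricLieAlgebra L C)

theorem ext_met {X Y : L} (h : ∀ Z, K.met X Z = K.met Y Z) : X = Y := by
  refine sub_eq_zero.1 (K.eq_zero_of_met_self _ ?_)
  rw [map_sub K.met, LinearMap.sub_apply, h, sub_self]

theorem eq_zero_of_eq_neg {V : Type*} [AddCommGroup V] [Module ℝ V] {a : V} (h : a = -a) :
    a = 0 := by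
  linear_combination (norm := module) (1 / 2 : ℝ) • h

/-- Two connections that are metric and have the same torsion agree. -/
theorem nab_unique {N : L → L → L}
    (hm : ∀ X Y Z, K.der X (K.met Y Z) = K.met (N X Y) Z + K.met Y (N X Z))
    (ht : ∀ X Y, N X Y - N Y X = K.br X Y) (X Y : L) : K.nab X Y = N X Y := by
  have hs (X Y : L) : K.nab X Y - N X Y = K.nab Y X - N Y X := by
    have h1 := K.nab_sub_nab X Y
    rw [← ht, sub_eq_sub_iff_add_eq_add] at h1
    rw [sub_eq_sub_iff_add_eq_add, h1, add_comm]
  have hk (X Y Z : L) : K.met (K.nab X Y - N X Y) Z = -K.met (K.nab X Z - N X Z) Y := by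
    have h1 := (K.der_met X Y Z).symm.trans (hm X Y Z)
    simp only [map_sub, LinearMap.sub_apply, K.met_comm _ Y] at h1 ⊢
    rw [← sub_eq_zero] at h1 ⊢
    rw [← h1]
    abel
  refine sub_eq_zero.1 (K.ext_met fun Z ↦ ?_)
  rw [map_zero, LinearMap.zero_apply]
  refine eq_zero_of_eq_neg ?_
  -- A trilinear form symmetric in the first two slots and skew in the last two is zero: alternating
  -- the two moves returns to the start after three sign changes.
  conv_lhs => rw [hk X Y Z, hs X Z, hk Z X Y, hs Z Y, hk Y Z X, hs Y X]
  simp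

/-- The curvature. -/
def R (X Y Z : L) : L := K.nab X (K.nab Y Z) - K.nab Y (K.nab X Z) - K.nab (K.br X Y) Z

/-- The bracket is not assumed bilinear; additivity comes from writing it as `∇_X Y - ∇_Y X`. -/
theorem R_add_left (X X' Y Z : L) : K.R (X + X') Y Z = K.R X Y Z + K.R X' Y Z := by
  simp only [R, ← K.nab_sub_nab, map_add, map_sub, LinearMap.add_apply, LinearMap.sub_apply]
  abel

theorem R_swap (X Y Z : L) : K.R X Y Z = -K.R Y X Z := by
  simp only [R, ← K.nab_sub_nab, map_sub, LinearMap.sub_apply]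
  abel

theorem R_add_mid (X Y Y' Z : L) : K.R X (Y + Y') Z = K.R X Y Z + K.R X Y' Z := by
  rw [R_swap, R_add_left, R_swap K X Y, R_swap K X Y', neg_add]

theorem R_add_right (X Y Z Z' : L) : K.R X Y (Z + Z') = K.R X Y Z + K.R X Y Z' := by
  simp only [R, map_add]
  abel

theorem R_neg_left (X Y Z : L) : K.R (-X) Y Z = -K.R X Y Z := by
  simp only [R, ← K.nab_sub_nab, map_neg, map_sub, LinearMap.neg_apply, LinearMap.sub_apply]
  abel

theorem R_neg_mid (X Y Z : L) : K.R X (-Y) Z = -K.R X Y Z := by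
  rw [R_swap, R_neg_left, R_swap K X Y]

theorem R_neg_right (X Y Z : L) : K.R X Y (-Z) = -K.R X Y Z := by
  simp only [R, map_neg]
  abel

theorem R_bianchi (X Y Z : L) : K.R X Y Z + K.R Y Z X + K.R Z X Y = 0 := by
  have h := K.jacobi X Y Z
  simp only [← K.nab_sub_nab, map_sub, LinearMap.sub_apply] at h
  rw [← sub_eq_zero] at h
  rw [← h]
  simp only [R, ← K.nab_sub_nab, map_sub, LinearMap.sub_apply]
  abel

/-- The operator `XY - YX - [X, Y]` kills the function `g(Z, W)`; expand by metricity. -/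
theorem met_R_skew (X Y Z W : L) : K.met (K.R X Y Z) W = -K.met (K.R X Y W) Z := by
  have h := K.der_br X Y (K.met Z W)
  simp only [K.der_met, map_add] at h
  simp only [R, map_sub, LinearMap.sub_apply]
  rw [K.met_comm Z, K.met_comm Z, K.met_comm Z] at h
  rw [← sub_eq_zero] at h ⊢
  rw [← neg_eq_zero, ← h]
  simp only [K.met_comm (K.nab Y Z), K.met_comm (K.nab X Z)]
  abel

theorem met_R_swap_pairs (X Y Z W : L) : K.met (K.R X Y Z) W = K.met (K.R Z W X) Y := by
  have b (X Y Z W : L) : K.met (K.R X Y Z) W + K.met (K.R Y Z X) W + K.met (K.R Z X Y) W = 0 := by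
    simpa using congrArg (fun V ↦ K.met V W) (K.R_bianchi X Y Z)
  have s (X Y Z W : L) : K.met (K.R X Y Z) W = -K.met (K.R Y X Z) W := by
    rw [R_swap]; simp
  have t := K.met_R_skew
  -- The octahedron argument: four cyclic Bianchi sums with signs `+ + - -`, reduced by the two skew
  -- symmetries.
  linear_combination (norm := module) (1 / 2 : ℝ) • b X Y Z W
    + (1 / 2 : ℝ) • (b Y Z W X - t Y Z W X - t Z W Y X - s W Y Z X)
    - (1 / 2 : ℝ) • (b Z W X Y - t W X Z Y - s X Z W Y + t Z X W Y)
    - (1 / 2 : ℝ) • (b W X Y Z - t X Y W Z - t Y W X Z)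

end MetricLieAlgebra

/-- The algebraic structure that a complex, Riemannian and totally geodesic foliation of a Kähler
manifold induces on vector fields. -/
structure KahlerFoliation (L C : Type*) [AddCommGroup L] [Module ℝ L] [AddCommGroup C]
    [Module ℝ C] extends MetricLieAlgebra L C where
  /-- the complex structure -/
  J : L →ₗ[ℝ] L
  /-- the projection onto the vertical vector fields -/
  P : L →ₗ[ℝ] L
  J_J : ∀ X, J (J X) = -X
  met_J_J : ∀ X Y, met (J X) (J Y) = met X Y
  nab_J : ∀ X Y, nab X (J Y) = J (nab X Y)
  P_P : ∀ X, P (P X) = P X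
  met_P_left : ∀ X Y, met (P X) Y = met X (P Y)
  P_J : ∀ X, P (J X) = J (P X)
  riemannian : ∀ U X Y, P U = U → P X = 0 → P Y = 0 →
    der U (met X Y) - met (br U X) Y - met X (br U Y) = 0
  geodesic : ∀ U W, P U = U → P W = W → P (nab U W) = nab U W

/-! ### Kähler curvature and orthogonal splitting -/

namespace KahlerFoliation

open MetricLieAlgebra

variable (K : KahlerFoliation L C)

theorem R_J (X Y Z : L) : K.R X Y (K.J Z) = K.J (K.R X Y Z) := by
  simp only [R, K.nab_J, map_sub]

/-- Pair symmetry moves both `J` to the last two slots, where `R` commutes with the orthogonal map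
`J`. -/
theorem R_J_J (X Y Z : L) : K.R (K.J X) (K.J Y) Z = K.R X Y Z := by
  refine K.ext_met fun W ↦ ?_
  rw [K.met_R_swap_pairs, R_J, K.met_J_J, ← K.met_R_swap_pairs]

/-- Vertical and horizontal vector fields are orthogonal. -/
theorem met_eq_zero {X U : L} (hX : K.P X = 0) (hU : K.P U = U) : K.met X U = 0 := by
  rw [← hU, ← K.met_P_left, hX, map_zero, LinearMap.zero_apply]

theorem met_eq_zero' {X U : L} (hX : K.P X = 0) (hU : K.P U = U) : K.met U X = 0 := by
  rw [K.met_comm, K.met_eq_zero hX hU]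

/-- A vertical vector field is determined by its products with vertical ones. -/
theorem ext_vertical {U V : L} (hU : K.P U = U) (hV : K.P V = V)
    (h : ∀ W, K.P W = W → K.met U W = K.met V W) : U = V := by
  refine K.ext_met fun Z ↦ ?_
  rw [← hU, ← hV, K.met_P_left, K.met_P_left V, h _ (K.P_P Z)]

/-- A horizontal vector field is determined by its products with horizontal ones. -/
theorem ext_horizontal {X Y : L} (hX : K.P X = 0) (hY : K.P Y = 0)
    (h : ∀ Z, K.P Z = 0 → K.met X Z = K.met Y Z) : X = Y := by
  refine K.ext_met fun Z ↦ ?_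
  have h1 := h (Z - K.P Z) (by simp [K.P_P])
  rwa [map_sub, map_sub, ← K.met_P_left, ← K.met_P_left, hX, hY, map_zero, LinearMap.zero_apply,
    sub_zero, sub_zero] at h1

/-! ### The Bott connection and the tensor `B` -/

/-- The Bott connection. -/
def D : L →ₗ[ℝ] L →ₗ[ℝ] L :=
  (K.nab.compl₂ K.P).compr₂ K.P
    + (K.nab.compl₂ (LinearMap.id - K.P)).compr₂ (LinearMap.id - K.P)

theorem D_apply (X Y : L) :
    K.D X Y = K.P (K.nab X (K.P Y)) + (K.nab X (Y - K.P Y) - K.P (K.nab X (Y - K.P Y))) := by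
  simp [D]

/-- The difference of the Levi-Civita and the Bott connection. -/
def B : L →ₗ[ℝ] L →ₗ[ℝ] L := K.nab - K.D

theorem nab_eq (X Y : L) : K.nab X Y = K.D X Y + K.B X Y := by
  simp [B]

theorem P_D (X Y : L) : K.P (K.D X Y) = K.D X (K.P Y) := by
  simp [D_apply, K.P_P]

theorem D_J (X Y : L) : K.D X (K.J Y) = K.J (K.D X Y) := by
  simp [D_apply, K.P_J, K.nab_J]

theorem B_J (X Y : L) : K.B X (K.J Y) = K.J (K.B X Y) := by
  simp [B, D_J, K.nab_J]

theorem P_B (X Y : L) : K.P (K.B X Y) = K.B X (Y - K.P Y) := by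
  simp [B, D_apply, K.P_P]

/-- Differentiate the relation `g(Y_V, Z_H) = 0`. -/
theorem B_skew (X Y Z : L) : K.met (K.B X Y) Z = -K.met (K.B X Z) Y := by
  have key (Y Z : L) : K.met (K.nab X (K.P Y)) (Z - K.P Z)
      = -K.met (K.nab X (Z - K.P Z)) (K.P Y) := by
    have h := K.der_met X (K.P Y) (Z - K.P Z)
    rw [K.met_eq_zero' (by simp [K.P_P]) (K.P_P Y), map_zero] at h
    rw [eq_neg_iff_add_eq_zero, h, K.met_comm (K.P Y)]
  have hB (Y : L) : K.B X Y = (K.nab X (K.P Y) - K.P (K.nab X (K.P Y)))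
      + K.P (K.nab X (Y - K.P Y)) := by
    rw [B, LinearMap.sub_apply, LinearMap.sub_apply, D_apply]
    simp only [map_sub]
    abel
  have hY := key Y Z
  have hZ := key Z Y
  rw [hB, hB]
  simp only [map_add, map_sub, LinearMap.add_apply, LinearMap.sub_apply, K.met_P_left] at hY hZ ⊢
  linear_combination (norm := module) hY + hZ

theorem der_met_D (X Y Z : L) :
    K.der X (K.met Y Z) = K.met (K.D X Y) Z + K.met Y (K.D X Z) := by
  have h := K.B_skew X Y Z
  rw [K.der_met, nab_eq, nab_eq, K.met_comm Y (_ + _), K.met_comm Y (K.D X Z)]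
  simp only [map_add, LinearMap.add_apply, h]
  abel

/-- On vertical `Y` this is total geodesy; skewness of `B_U` carries it over to horizontal `Y`. -/
theorem B_of_vertical {U : L} (hU : K.P U = U) (Y : L) : K.B U Y = 0 := by
  have h1 (W : L) (hW : K.P W = W) : K.B U W = 0 := by
    simp [B, D_apply, hW, K.geodesic U W hU hW]
  refine K.ext_met fun Z ↦ ?_
  rw [map_zero, LinearMap.zero_apply]
  have hP (Y Z : L) : K.met (K.B U Y) (K.P Z) = 0 := by
    rw [B_skew, h1 _ (K.P_P Z)]; simp
  rw [← add_sub_cancel (K.P Y) Y, map_add, h1 _ (K.P_P Y), zero_add, ← P_B, K.met_P_left, hP]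

/-- For vertical `U`, `(L_U g)(X, Y) = g(∇_X U, Y) + g(X, ∇_Y U) = -g(B_X Y + B_Y X, U)`. -/
theorem B_of_horizontal {X Y : L} (hX : K.P X = 0) (hY : K.P Y = 0) : K.B X Y = -K.B Y X := by
  have hv (X Y : L) (hY : K.P Y = 0) : K.P (K.B X Y) = K.B X Y := by simp [P_B, hY]
  refine K.ext_vertical (hv X Y hY) (by rw [map_neg, hv Y X hX]) fun U hU ↦ ?_
  have h := K.riemannian U X Y hU hX hY
  rw [K.der_met, ← K.nab_sub_nab, ← K.nab_sub_nab] at h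
  have e (X Y : L) (hX : K.P X = 0) (hY : K.P Y = 0) : K.met (K.nab X U) Y
      = -K.met (K.B X Y) U := by
    rw [← B_skew, nab_eq, map_add, LinearMap.add_apply, K.met_eq_zero' hY, zero_add]
    rw [P_D, hU]
  simp only [map_sub, LinearMap.sub_apply, map_neg, LinearMap.neg_apply,
    K.met_comm X (K.nab Y U), e X Y hX hY, e Y X hY hX] at h ⊢
  linear_combination (norm := module) -h

theorem B_J_left_horizontal {X Y : L} (hX : K.P X = 0) (hY : K.P Y = 0) :
    K.B (K.J X) Y = K.J (K.B X Y) := by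
  rw [K.B_of_horizontal (by simp [K.P_J, hX]) hY, B_J, K.B_of_horizontal hY hX, map_neg, neg_neg]

/-- Dual to the horizontal case under skewness of `B`; the sign appears because `J` is skew for `g`.
-/
theorem B_J_left_vertical {X U : L} (hX : K.P X = 0) (hU : K.P U = U) :
    K.B (K.J X) U = -K.J (K.B X U) := by
  have hh (X : L) : K.P (K.B X U) = 0 := by simp [P_B, hU]
  refine K.ext_horizontal (hh _) (by simp [K.P_J, hh]) fun Z hZ ↦ ?_
  rw [B_skew, K.B_J_left_horizontal hX hZ, ← K.met_J_J, K.J_J, ← B_J, map_neg, map_neg,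
    LinearMap.neg_apply, LinearMap.neg_apply, neg_neg, B_skew]

/-! ### Parallelism of `B` from O'Neill's formulas -/

/-- The torsion of the Bott connection. -/
def T (X Y : L) : L := K.B Y X - K.B X Y

/-- The curvature of the Bott connection. -/
def RD (X Y Z : L) : L := K.D X (K.D Y Z) - K.D Y (K.D X Z) - K.D (K.br X Y) Z

/-- The derivative of `B` with respect to the Bott connection. -/
def DB (X Y Z : L) : L := K.D X (K.B Y Z) - K.B (K.D X Y) Z - K.B Y (K.D X Z)

theorem P_RD (X Y Z : L) : K.P (K.RD X Y Z) = K.RD X Y (K.P Z) := by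
  simp [RD, P_D]

theorem D_vertical (X : L) {U : L} (hU : K.P U = U) : K.P (K.D X U) = K.D X U := by
  rw [P_D, hU]

theorem D_horizontal (X : L) {Y : L} (hY : K.P Y = 0) : K.P (K.D X Y) = 0 := by
  rw [P_D, hY, map_zero]

theorem B_vertical (X : L) {U : L} (hU : K.P U = U) : K.P (K.B X U) = 0 := by
  simp [P_B, hU]

theorem B_horizontal (X : L) {Y : L} (hY : K.P Y = 0) : K.P (K.B X Y) = K.B X Y := by
  simp [P_B, hY]

theorem DB_of_vertical (X : L) {U : L} (hU : K.P U = U) (Y : L) : K.DB X U Y = 0 := by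
  simp [DB, K.B_of_vertical hU, K.B_of_vertical (K.D_vertical X hU)]

theorem DB_of_horizontal (X : L) {Y Z : L} (hY : K.P Y = 0) (hZ : K.P Z = 0) :
    K.DB X Y Z = -K.DB X Z Y := by
  rw [DB, K.B_of_horizontal hY hZ, K.B_of_horizontal (K.D_horizontal X hY) hZ,
    K.B_of_horizontal hY (K.D_horizontal X hZ), DB, map_neg]
  abel

theorem DB_J (X Y Z : L) : K.DB X Y (K.J Z) = K.J (K.DB X Y Z) := by
  simp [DB, D_J, B_J]

theorem P_DB_vertical (X Y : L) {U : L} (hU : K.P U = U) : K.P (K.DB X Y U) = 0 := by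
  simp [DB, P_D, P_B, hU]

theorem P_DB_horizontal (X Y : L) {Z : L} (hZ : K.P Z = 0) :
    K.P (K.DB X Y Z) = K.DB X Y Z := by
  simp [DB, P_D, P_B, hZ]

theorem DB_skew (X Y Z W : L) : K.met (K.DB X Y Z) W = -K.met (K.DB X Y W) Z := by
  have h1 := K.der_met_D X (K.B Y Z) W
  have h2 := K.der_met_D X (K.B Y W) Z
  have h3 := congrArg (K.der X) (K.B_skew Y Z W)
  rw [map_neg, h1, h2] at h3
  have h4 := K.B_skew (K.D X Y) Z W
  have h5 := K.B_skew Y (K.D X Z) W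
  have h6 := K.B_skew Y Z (K.D X W)
  simp only [DB, map_sub, LinearMap.sub_apply]
  linear_combination (norm := module) h3 - h4 - h5 - h6

theorem R_eq (X Y Z : L) : K.R X Y Z = K.RD X Y Z + K.DB X Y Z - K.DB Y X Z
    + K.B (K.T X Y) Z + K.B X (K.B Y Z) - K.B Y (K.B X Z) := by
  simp only [R, RD, DB, T, ← K.nab_sub_nab, nab_eq, map_add, map_sub, LinearMap.add_apply,
    LinearMap.sub_apply]
  abel

/-- The curvature of `D` preserves the splitting and drops out. As `B_U = 0`, only `DB` and the
torsion term `B_{B_X U} W` survive. -/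
theorem met_R_of_vertical_horizontal {U W X Y : L} (hU : K.P U = U) (hW : K.P W = W)
    (hY : K.P Y = 0) :
    K.met (K.R U X W) Y = K.met (K.DB U X W) Y - K.met (K.B Y W) (K.B X U) := by
  have h1 : K.met (K.RD U X W) Y = 0 := K.met_eq_zero' hY (by rw [P_RD, hW])
  have h2 : K.met (K.B (K.B X U) W) Y = -K.met (K.B Y W) (K.B X U) := by
    rw [B_skew, K.B_of_horizontal (K.B_vertical X hU) hY, map_neg, LinearMap.neg_apply, neg_neg,
      B_skew]
  rw [R_eq, K.DB_of_vertical X hU, T, K.B_of_vertical hU X, K.B_of_vertical hU (K.B X W),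
    K.B_of_vertical hU W]
  simp [h1, h2, sub_eq_add_neg]

/-- The Bott connection is torsion parallel along the leaves. -/
theorem met_DB_of_vertical {U W X Y : L} (hU : K.P U = U) (hW : K.P W = W)
    (hX : K.P X = 0) (hY : K.P Y = 0) : K.met (K.DB U X W) Y = 0 := by
  have hJ {U : L} (hU : K.P U = U) : K.P (K.J U) = K.J U := by rw [K.P_J, hU]
  have hJ' {X : L} (hX : K.P X = 0) : K.P (K.J X) = 0 := by rw [K.P_J, hX, map_zero]
  -- Pair symmetry of `R(U, X, W, Y)`: the quadratic terms in `B` agree on both sides and cancel.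
  have skew {U W X Y : L} (hU : K.P U = U) (hW : K.P W = W) (hX : K.P X = 0) (hY : K.P Y = 0) :
      K.met (K.DB U X W) Y = -K.met (K.DB W X U) Y := by
    have h1 := K.met_R_swap_pairs U X W Y
    rw [K.met_R_of_vertical_horizontal hU hW hY, K.met_R_of_vertical_horizontal hW hU hX,
      K.met_comm (K.B X U), sub_left_inj] at h1
    rw [h1, DB_skew, K.DB_of_horizontal W hY hX, map_neg, LinearMap.neg_apply, neg_neg, DB_skew]
  have bianchi {U W : L} (hU : K.P U = U) (hW : K.P W = W) :
      K.met (K.R U W X) Y = (2 : ℝ) • K.met (K.DB U X W) Y + K.met (K.B Y U) (K.B X W)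
        - K.met (K.B Y W) (K.B X U) := by
    have h1 := congrArg (fun V ↦ K.met V Y) (K.R_bianchi U W X)
    simp only [K.R_swap X U, map_add, map_neg, LinearMap.add_apply, LinearMap.neg_apply, map_zero,
      LinearMap.zero_apply, K.met_R_of_vertical_horizontal hU hW hY,
      K.met_R_of_vertical_horizontal hW hU hY] at h1
    linear_combination (norm := module) h1 - skew hU hW hX hY
  have flip : K.met (K.DB (K.J U) X (K.J W)) Y = -K.met (K.DB U X W) Y := by
    rw [DB_J, ← K.met_J_J, K.J_J, map_neg, LinearMap.neg_apply,
      skew (hJ hU) hW hX (hJ' hY), DB_J, K.met_J_J, neg_neg, skew hW hU hX hY]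
  have h1 := bianchi hU hW
  have h2 := bianchi (hJ hU) (hJ hW)
  rw [R_J_J, flip] at h2
  simp only [B_J, K.met_J_J] at h2
  -- Replacing `U`, `W` by `JU`, `JW` keeps `R` and the quadratic terms but negates `2 DB`; the
  -- difference is `4 DB = 0`.
  linear_combination (norm := module) (1 / 4 : ℝ) • (h2 - h1)

theorem met_R_of_horizontal {X Y Z U : L} (hX : K.P X = 0) (hY : K.P Y = 0) (hZ : K.P Z = 0)
    (hU : K.P U = U) :
    K.met (K.R X Y Z) U = K.met (K.DB X Y Z) U - K.met (K.DB Y X Z) U := by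
  have h1 : K.met (K.RD X Y Z) U = 0 := K.met_eq_zero (by rw [P_RD, hZ]; simp [RD]) hU
  have hT : K.P (K.T X Y) = K.T X Y := by
    rw [T, map_sub, K.B_horizontal X hY, K.B_horizontal Y hX]
  have h2 (X Y : L) : K.met (K.B X (K.B Y Z)) U = 0 :=
    K.met_eq_zero (K.B_vertical X (K.B_horizontal Y hZ)) hU
  rw [R_eq, K.B_of_vertical hT]
  simp [h1, h2]

theorem met_DB_of_horizontal {X Y Z U : L} (hX : K.P X = 0) (hY : K.P Y = 0) (hZ : K.P Z = 0)
    (hU : K.P U = U) : K.met (K.DB X Y Z) U = 0 := by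
  have hJ {X : L} (hX : K.P X = 0) : K.P (K.J X) = 0 := by rw [K.P_J, hX, map_zero]
  have sk (X : L) {Y Z : L} (hY : K.P Y = 0) (hZ : K.P Z = 0) :
      K.met (K.DB X Y Z) U = -K.met (K.DB X Z Y) U := by
    rw [K.DB_of_horizontal X hY hZ, map_neg, LinearMap.neg_apply]
  -- Bianchi together with skewness of `DB` in its last two slots makes the cyclic sum of `DB`
  -- vanish. Then `J`-invariance of `R` in its first pair meets the sign in `flip`.
  have key {X Y Z : L} (hX : K.P X = 0) (hY : K.P Y = 0) (hZ : K.P Z = 0) :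
      K.met (K.R X Y Z) U = -K.met (K.DB Z X Y) U := by
    have h1 := congrArg (fun V ↦ K.met V U) (K.R_bianchi X Y Z)
    simp only [map_add, LinearMap.add_apply, map_zero, LinearMap.zero_apply,
      K.met_R_of_horizontal hX hY hZ hU, K.met_R_of_horizontal hY hZ hX hU,
      K.met_R_of_horizontal hZ hX hY hU] at h1
    rw [K.met_R_of_horizontal hX hY hZ hU]
    linear_combination (norm := module) (1 / 2 : ℝ) • (h1 + sk X hY hZ - sk Y hX hZ + sk Z hX hY)
  have flip : K.DB X (K.J Y) (K.J Z) = -K.DB X Y Z := by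
    rw [DB_J, K.DB_of_horizontal X (hJ hY) hZ, DB_J, map_neg, K.J_J, neg_neg,
      K.DB_of_horizontal X hZ hY]
  have h1 := key hY hZ hX
  rw [← R_J_J, key (hJ hY) (hJ hZ) hX, flip, map_neg, LinearMap.neg_apply, neg_neg] at h1
  exact eq_zero_of_eq_neg h1

/-- The tensor `B` is parallel for the Bott connection. -/
theorem DB_eq_zero (X Y Z : L) : K.DB X Y Z = 0 := by
  have add_left (X X' Y Z : L) : K.DB (X + X') Y Z = K.DB X Y Z + K.DB X' Y Z := by
    simp only [DB, map_add, LinearMap.add_apply]; abel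
  have add_mid (X Y Y' Z : L) : K.DB X (Y + Y') Z = K.DB X Y Z + K.DB X Y' Z := by
    simp only [DB, map_add, LinearMap.add_apply]; abel
  have add_right (X Y Z Z' : L) : K.DB X Y (Z + Z') = K.DB X Y Z + K.DB X Y Z' := by
    simp only [DB, map_add]; abel
  have hQ (X : L) : K.P (X - K.P X) = 0 := by simp [K.P_P]
  have hor {Y Z : L} (hY : K.P Y = 0) (hZ : K.P Z = 0) : K.DB X Y Z = 0 := by
    refine K.ext_vertical (K.P_DB_horizontal X Y hZ) (map_zero _) fun U hU ↦ ?_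
    rw [← add_sub_cancel (K.P X) X, add_left, map_add, LinearMap.add_apply,
      K.met_DB_of_horizontal (hQ X) hY hZ hU, DB_skew, K.met_DB_of_vertical (K.P_P X) hU hY hZ]
    simp
  -- Skewness of `DB` reduces a vertical last slot to the horizontal case.
  have ver {Y W : L} (hY : K.P Y = 0) (hW : K.P W = W) : K.DB X Y W = 0 := by
    refine K.ext_horizontal (K.P_DB_vertical X Y hW) (map_zero _) fun Z hZ ↦ ?_
    rw [DB_skew, hor hY hZ]
    simp
  rw [← add_sub_cancel (K.P Y) Y, add_mid, K.DB_of_vertical X (K.P_P Y), zero_add,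
    ← add_sub_cancel (K.P Z) Z, add_right, hor (hQ Y) (hQ Z), ver (hQ Y) (K.P_P Z), add_zero]

theorem D_B (W X Y : L) : K.D W (K.B X Y) = K.B (K.D W X) Y + K.B X (K.D W Y) := by
  have h := K.DB_eq_zero W X Y
  rw [DB, sub_sub, sub_eq_zero] at h
  exact h

theorem RD_eq (X Y Z : L) : K.RD X Y Z = K.R X Y Z - K.B (K.T X Y) Z - K.B X (K.B Y Z)
    + K.B Y (K.B X Z) := by
  rw [R_eq, DB_eq_zero, DB_eq_zero]
  abel

theorem D_T (W X Y : L) : K.D W (K.T X Y) = K.T (K.D W X) Y + K.T X (K.D W Y) := by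
  simp only [T, map_sub, D_B]
  abel

/-! ### Reflection in the leaves and parallel curvature -/

/-- The reflection in the leaves. -/
def S : L →ₗ[ℝ] L := (2 : ℝ) • K.P - LinearMap.id

theorem S_apply (X : L) : K.S X = (2 : ℝ) • K.P X - X := by simp [S]

theorem S_S (X : L) : K.S (K.S X) = X := by
  simp only [S_apply, map_sub, map_smul, K.P_P]
  module

theorem D_S (W X : L) : K.D W (K.S X) = K.S (K.D W X) := by
  simp [S_apply, P_D]

theorem B_S (W X : L) : K.B W (K.S X) = -K.S (K.B W X) := by
  simp only [S_apply, P_B, map_sub, map_smul]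
  module

theorem P_R_of_vertical {X Y : L} (hX : K.P X = X) (hY : K.P Y = Y) (Z : L) :
    K.P (K.R X Y Z) = K.R X Y (K.P Z) := by
  rw [R_eq, R_eq, T]
  simp [K.B_of_vertical hX, K.B_of_vertical hY, DB_eq_zero, P_RD]

theorem P_R_of_horizontal {X Y : L} (hX : K.P X = 0) (hY : K.P Y = 0) (Z : L) :
    K.P (K.R X Y Z) = K.R X Y (K.P Z) := by
  have hT : K.P (K.T X Y) = K.T X Y := by
    rw [T, map_sub, K.B_horizontal X hY, K.B_horizontal Y hX]
  rw [R_eq, R_eq, K.B_of_vertical hT, K.B_of_vertical hT]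
  simp [DB_eq_zero, P_RD, P_B]

/-- Pair symmetry turns the components that should vanish into components of an unmixed curvature
operator between `V` and `H`, and those operators preserve the splitting. -/
theorem P_R_of_vertical_horizontal {U X : L} (hU : K.P U = U) (hX : K.P X = 0) (Z : L) :
    K.P (K.R U X Z) = K.R U X (Z - K.P Z) := by
  have hv {W : L} (hW : K.P W = W) : K.P (K.R U X W) = 0 := by
    refine K.ext_vertical (K.P_P _) (map_zero _) fun W' hW' ↦ ?_
    rw [K.met_P_left, hW', K.met_R_swap_pairs,
      K.met_eq_zero' hX (by rw [K.P_R_of_vertical hW hW', hU])]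
    simp
  have hh {Y : L} (hY : K.P Y = 0) : K.P (K.R U X Y) = K.R U X Y := by
    refine sub_eq_zero.1 (K.ext_horizontal (X := K.P (K.R U X Y) - K.R U X Y) (Y := 0)
      (by simp [K.P_P]) (map_zero _) fun Y' hY' ↦ ?_)
    rw [map_sub, LinearMap.sub_apply, K.met_P_left, hY', map_zero, zero_sub, K.met_R_swap_pairs,
      K.met_eq_zero' hX (by rw [K.P_R_of_horizontal hY hY', hU])]
    simp
  conv_lhs => rw [← add_sub_cancel (K.P Z) Z, R_add_right, map_add, hv (K.P_P Z), zero_add,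
    hh (by simp [K.P_P])]

/-- The curvature is invariant under the reflection in the leaves. -/
theorem R_S (X Y Z : L) : K.R (K.S X) (K.S Y) (K.S Z) = K.S (K.R X Y Z) := by
  have hQ (X : L) : K.P (X - K.P X) = 0 := by simp [K.P_P]
  have hs (X : L) : K.S X = K.P X + -(X - K.P X) := by rw [S_apply]; module
  have hd (X : L) : X = K.P X + (X - K.P X) := by abel
  have even {X Y : L} (h : ∀ Z, K.P (K.R X Y Z) = K.R X Y (K.P Z)) (Z : L) :
      K.R X Y (K.S Z) = K.S (K.R X Y Z) := by
    have h1 : K.R X Y Z = K.R X Y (K.P Z) + K.R X Y (Z - K.P Z) := by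
      rw [← R_add_right, add_sub_cancel]
    rw [S_apply K (K.R X Y Z), h, hs, R_add_right, R_neg_right, h1]
    module
  have odd {X Y : L} (h : ∀ Z, K.P (K.R X Y Z) = K.R X Y (Z - K.P Z)) (Z : L) :
      K.R X Y (K.S Z) = -K.S (K.R X Y Z) := by
    have h1 : K.R X Y Z = K.R X Y (K.P Z) + K.R X Y (Z - K.P Z) := by
      rw [← R_add_right, add_sub_cancel]
    rw [S_apply K (K.R X Y Z), h, hs, R_add_right, R_neg_right, h1]
    module
  have h1 := even (K.P_R_of_vertical (K.P_P X) (K.P_P Y)) Z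
  have h2 := even (K.P_R_of_horizontal (hQ X) (hQ Y)) Z
  have h3 := odd (K.P_R_of_vertical_horizontal (K.P_P X) (hQ Y)) Z
  have h4 := odd (K.P_R_of_vertical_horizontal (K.P_P Y) (hQ X)) Z
  rw [K.R_swap (K.P Y), K.R_swap (K.P Y) _ Z, map_neg, neg_neg, neg_eq_iff_eq_neg] at h4
  conv_rhs => rw [hd X, hd Y]
  rw [hs X, hs Y]
  simp only [R_add_left, R_add_mid, R_neg_left, R_neg_mid, map_add, h1, h2, h3, h4, neg_neg]
  abel

theorem D_R (hpar : ∀ W X Y Z, K.nab W (K.R X Y Z)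
      = K.R (K.nab W X) Y Z + K.R X (K.nab W Y) Z + K.R X Y (K.nab W Z)) (W X Y Z : L) :
    K.D W (K.R X Y Z) = K.R (K.D W X) Y Z + K.R X (K.D W Y) Z + K.R X Y (K.D W Z) := by
  have h1 := hpar W X Y Z
  -- Conjugating `∇R = 0` by `S` replaces `∇_W = D_W + B_W` by `D_W - B_W`, so the sum loses all `B`
  -- terms.
  have h2 := congrArg K.S (hpar W (K.S X) (K.S Y) (K.S Z))
  simp only [nab_eq, R_add_left, R_add_mid, R_add_right, R_neg_left, R_neg_mid, R_neg_right, D_S,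
    B_S, R_S, map_add, map_neg, S_S] at h1 h2
  linear_combination (norm := module) (1 / 2 : ℝ) • (h1 + h2)

theorem D_RD (hpar : ∀ W X Y Z, K.nab W (K.R X Y Z)
      = K.R (K.nab W X) Y Z + K.R X (K.nab W Y) Z + K.R X Y (K.nab W Z)) (W X Y Z : L) :
    K.D W (K.RD X Y Z) = K.RD (K.D W X) Y Z + K.RD X (K.D W Y) Z + K.RD X Y (K.D W Z) := by
  simp only [RD_eq, map_add, map_sub, K.D_R hpar, D_B, D_T, LinearMap.add_apply]
  abel

/-! ### The canonical variation and its nearly Kähler structure -/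

/-- The metric of the canonical variation with parameter `1 / 2`. -/
def nkMet (X Y : L) : C :=
  (1 / 2 : ℝ) • K.met (K.P X) (K.P Y) + K.met (X - K.P X) (Y - K.P Y)

/-- The Levi-Civita connection of the canonical variation with parameter `1 / 2`. -/
def nkNab (X Y : L) : L := K.D X Y + (1 / 2 : ℝ) • (K.B X Y - K.B Y X)

/-- The almost complex structure of the canonical variation. -/
def nkJ (X : L) : L := K.J (X - K.P X) - K.J (K.P X)

theorem der_nkMet_D (X Y Z : L) :
    K.der X (K.nkMet Y Z) = K.nkMet (K.D X Y) Z + K.nkMet Y (K.D X Z) := by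
  simp only [nkMet, map_add, map_smul, der_met_D, P_D, map_sub, LinearMap.sub_apply]
  module

theorem nkNab_sub_nkNab (X Y : L) : K.nkNab X Y - K.nkNab Y X = K.br X Y := by
  rw [← K.nab_sub_nab, nab_eq, nab_eq, nkNab, nkNab]
  module

theorem B_eq (X Y : L) : K.B X Y = K.B (X - K.P X) (K.P Y) + K.B (X - K.P X) (Y - K.P Y) := by
  rw [← map_add, add_sub_cancel, map_sub, LinearMap.sub_apply, K.B_of_vertical (K.P_P X), sub_zero]

theorem B_sub_B_eq (X Y : L) : K.B X Y - K.B Y X = (2 : ℝ) • K.B (X - K.P X) (Y - K.P Y)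
    + (K.B (X - K.P X) (K.P Y) - K.B (Y - K.P Y) (K.P X)) := by
  have hQ (X : L) : K.P (X - K.P X) = 0 := by simp [K.P_P]
  rw [B_eq, K.B_eq Y, K.B_of_horizontal (hQ Y) (hQ X)]
  module

theorem P_B_sub_B (X Y : L) :
    K.P (K.B X Y - K.B Y X) = (2 : ℝ) • K.B (X - K.P X) (Y - K.P Y) := by
  have hQ (X : L) : K.P (X - K.P X) = 0 := by simp [K.P_P]
  rw [B_sub_B_eq, map_add, map_smul, K.B_horizontal _ (hQ Y), LinearMap.map_sub K.P (K.B _ (K.P Y)),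
    K.B_vertical _ (K.P_P Y), K.B_vertical _ (K.P_P X), sub_zero, add_zero]

/-- The vertical part of `B_X Y - B_Y X` is `2 B_{X_H} Y_H`, while its horizontal part carries no
factor `2`. The weight `t = 1/2` on `V` balances them and makes the torsion of `D` totally skew. -/
theorem nkMet_B_sub_B_skew (X Y Z : L) :
    K.nkMet (K.B X Y - K.B Y X) Z = -K.nkMet Y (K.B X Z - K.B Z X) := by
  have hQ (X : L) : K.P (X - K.P X) = 0 := by simp [K.P_P]
  have h1 := K.B_skew (X - K.P X) (Y - K.P Y) (K.P Z)
  have h2 := K.B_skew (X - K.P X) (K.P Y) (Z - K.P Z)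
  have h3 := K.B_skew (Y - K.P Y) (K.P X) (Z - K.P Z)
  have h4 := K.B_skew (Z - K.P Z) (K.P X) (Y - K.P Y)
  rw [K.B_of_horizontal (hQ Y) (hQ Z), map_neg, LinearMap.neg_apply] at h3
  have c1 := K.met_comm (K.P Y) (K.B (X - K.P X) (Z - K.P Z))
  have c2 := K.met_comm (Y - K.P Y) (K.B (X - K.P X) (K.P Z))
  have c3 := K.met_comm (Y - K.P Y) (K.B (Z - K.P Z) (K.P X))
  rw [nkMet, nkMet, P_B_sub_B, P_B_sub_B, B_sub_B_eq, B_sub_B_eq, add_sub_cancel_left,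
    add_sub_cancel_left]
  generalize X - K.P X = x, Y - K.P Y = y, Z - K.P Z = z at *
  simp only [map_smul, LinearMap.smul_apply, map_sub, LinearMap.sub_apply, c1, c2, c3]
  linear_combination (norm := module) h1 + h2 - h3 - h4

theorem der_nkMet (X Y Z : L) :
    K.der X (K.nkMet Y Z) = K.nkMet (K.nkNab X Y) Z + K.nkMet Y (K.nkNab X Z) := by
  have h := K.nkMet_B_sub_B_skew X Y Z
  rw [der_nkMet_D]
  have e1 (X Y Z : L) : K.nkMet (X + (1 / 2 : ℝ) • Y) Z
      = K.nkMet X Z + (1 / 2 : ℝ) • K.nkMet Y Z := by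
    simp only [nkMet, map_add, map_smul, map_sub, LinearMap.add_apply, LinearMap.smul_apply,
      LinearMap.sub_apply]
    module
  have e2 (X Y Z : L) : K.nkMet Z (X + (1 / 2 : ℝ) • Y)
      = K.nkMet Z X + (1 / 2 : ℝ) • K.nkMet Z Y := by
    simp only [nkMet, map_add, map_smul, map_sub]
    module
  rw [nkNab, nkNab, e1, e2, h]
  module

theorem D_nkJ (X Y : L) : K.D X (K.nkJ Y) = K.nkJ (K.D X Y) := by
  simp only [nkJ, map_sub, D_J, P_D]

theorem P_nkJ (X : L) : K.P (K.nkJ X) = -K.J (K.P X) := by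
  simp [nkJ, K.P_J, K.P_P]

theorem nkJ_sub_P_nkJ (X : L) : K.nkJ X - K.P (K.nkJ X) = K.J (X - K.P X) := by
  rw [P_nkJ, nkJ]
  abel

/-- The torsion of the Bott connection anticommutes with the almost complex structure. -/
theorem B_sub_B_nkJ (X Y : L) :
    K.B X (K.nkJ Y) - K.B (K.nkJ Y) X = -K.nkJ (K.B X Y - K.B Y X) := by
  have hQ (X : L) : K.P (X - K.P X) = 0 := by simp [K.P_P]
  -- The vertical and horizontal parts are compared separately. In both, the sign `-J` on `V` and
  -- the sign in `B_J_left_vertical` combine to give anticommutation.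
  rw [nkJ.eq_def K (_ - _), P_B_sub_B, B_sub_B_eq, B_sub_B_eq, add_sub_cancel_left, nkJ_sub_P_nkJ,
    P_nkJ, K.B_J_left_vertical (hQ Y) (K.P_P X)]
  generalize X - K.P X = x, Y - K.P Y = y at *
  simp only [map_neg, B_J, map_sub, map_smul]
  abel

theorem nkNab_nkJ_self (X : L) : K.nkNab X (K.nkJ X) = K.nkJ (K.nkNab X X) := by
  rw [nkNab, nkNab, B_sub_B_nkJ, D_nkJ]
  simp [nkJ]

theorem nkJ_nkJ (X : L) : K.nkJ (K.nkJ X) = -X := by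
  simp only [nkJ, map_sub, K.P_J, K.P_P, K.J_J]
  abel

/-- With `A = B_X Y - B_Y X`, the derivative of the structure is `-nkJ A`. Since `nkJ` squares to
`-1`, the correction is `-A/2`, which cancels the `A/2` in `nkNab`. -/
theorem nkNab_sub_nkJ (X Y : L) :
    K.nkNab X Y - (1 / 2 : ℝ) • K.nkJ (K.nkNab X (K.nkJ Y) - K.nkJ (K.nkNab X Y)) = K.D X Y := by
  have e (X Y : L) (a : ℝ) : K.nkJ (X + a • Y) = K.nkJ X + a • K.nkJ Y := by
    simp only [nkJ, map_add, map_sub, map_smul]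
    module
  have e' (X : L) : K.nkJ (-X) = -K.nkJ X := by
    simp only [nkJ, map_sub, map_neg]
    abel
  have h : K.nkNab X (K.nkJ Y) - K.nkJ (K.nkNab X Y)
      = 0 + (-1 : ℝ) • K.nkJ (K.B X Y - K.B Y X) := by
    rw [nkNab, nkNab, B_sub_B_nkJ, D_nkJ, e]
    module
  rw [h, e, nkJ_nkJ, nkNab]
  simp [nkJ]

end KahlerFoliation

end Algebra

/-! ### From the algebra back to the manifold -/

section Concrete

variable {E : Type*} [NormedAddCommGroup E] [NormedSpace ℝ E] [CompleteSpace E]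
  {M : Type*} [TopologicalSpace M] [ChartedSpace E M] [IsManifold 𝓘(ℝ, E) ∞ M]

variable (E M) in
/-- The space of smooth vector fields. -/
def smoothFields : Submodule ℝ (VField E M) where
  carrier := {X | IsSmooth X}
  add_mem' hX hY := hX.add hY
  zero_mem' := isSmooth_zero
  smul_mem' c _ hX := hX.const_smul c

variable (E M) in
/-- The space of smooth functions. -/
def smoothFunctions : Submodule ℝ (M → ℝ) where
  carrier := {f | IsSmoothFun E f}
  add_mem' hf hh := ContMDiff.add hf hh
  zero_mem' := contMDiff_const
  smul_mem' _ _ hf := contMDiff_const.mul hf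

theorem der_const_smul (X : VField E M) (c : ℝ) {f : M → ℝ} (hf : IsSmoothFun E f) :
    der X (c • f) = c • der X f := by
  ext x
  have h := der_mul_fun X (f := fun _ ↦ c) (h := f) (x := x) mdifferentiableAt_const (hf.mdiffAt x)
  have h0 : der X (fun _ ↦ c) x = 0 := by simp [der, mvfderiv_const]
  rw [h0, zero_mul, add_zero] at h
  exact h

theorem nabla_add_right (D : Connection E M) (X : VField E M) {Y Y' : VField E M}
    (hY : IsSmooth Y) (hY' : IsSmooth Y') : nabla D X (Y + Y') = nabla D X Y + nabla D X Y' := by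
  ext x
  simp [nabla, D.isCovariantDerivativeOn.add (hY.diffAt x) (hY'.diffAt x)]

theorem nabla_smul_right (D : Connection E M) (X : VField E M) (c : ℝ) {Y : VField E M}
    (hY : IsSmooth Y) : nabla D X (c • Y) = c • nabla D X Y := by
  ext x
  simp [nabla, D.isCovariantDerivativeOn.smul_const c (hY.diffAt x)]

variable [FiniteDimensional ℝ E] [T2Space M]

/-- A Riemannian metric as an algebraic structure on smooth vector fields. -/
def metricAlgebra (g : Metric E M) :
    MetricLieAlgebra (smoothFields E M) (smoothFunctions E M) where
  met := LinearMap.mk₂ ℝ (fun X Y ↦ ⟨pair g X.1 Y.1, X.2.pair g Y.2⟩)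
    (fun X X' Y ↦ Subtype.ext (pair_add_left g X.1 X'.1 Y.1))
    (fun c X Y ↦ Subtype.ext (by ext x; simp [pair]))
    (fun X Y Y' ↦ Subtype.ext (pair_add_right g X.1 Y.1 Y'.1))
    (fun c X Y ↦ Subtype.ext (by ext x; simp [pair]))
  der := LinearMap.mk₂ ℝ (fun X f ↦ ⟨der X.1 f.1, f.2.der X.2⟩)
    (fun X X' f ↦ Subtype.ext (by ext x; simp [der]))
    (fun c X f ↦ Subtype.ext (by ext x; simp [der]))
    (fun X f f' ↦ Subtype.ext (by ext x; exact der_add_fun X.1 (f.2.mdiffAt x) (f'.2.mdiffAt x)))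
    (fun c X f ↦ Subtype.ext (der_const_smul X.1 c f.2))
  br X Y := ⟨bracket X.1 Y.1, X.2.bracket Y.2⟩
  nab := LinearMap.mk₂ ℝ (fun X Y ↦ ⟨nabla (leviCivita g) X.1 Y.1, IsSmooth.leviCivita g X.2 Y.2⟩)
    (fun X X' Y ↦ Subtype.ext (by ext x; simp [nabla]))
    (fun c X Y ↦ Subtype.ext (by ext x; simp [nabla]))
    (fun X Y Y' ↦ Subtype.ext (nabla_add_right _ X.1 Y.2 Y'.2))
    (fun c X Y ↦ Subtype.ext (nabla_smul_right _ X.1 c Y.2))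
  met_comm X Y := Subtype.ext (pair_comm g X.1 Y.1)
  eq_zero_of_met_self X h := Subtype.ext (by
    ext x
    by_contra hne
    exact (g.pos x _ hne).ne' (congrFun (congrArg Subtype.val h) x))
  der_met X Y Z := Subtype.ext (by ext x; exact leviCivita_metric g X.1 Y.1 Z.1 X.2 Y.2 Z.2 x)
  nab_sub_nab X Y := Subtype.ext (leviCivita_torsion_free g X.2 Y.2)
  der_br X Y f := Subtype.ext (der_bracket X.2 Y.2 f.2)
  jacobi X Y Z := Subtype.ext (bracket_jacobi X.2 Y.2 Z.2)

/-- A field of endomorphisms as a map of smooth vector fields. -/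
def EndField.toLinearMap (A : EndField E M) : smoothFields E M →ₗ[ℝ] smoothFields E M where
  toFun X := ⟨A.app X.1, X.2.app A⟩
  map_add' X Y := Subtype.ext (by ext x; simp [EndField.app])
  map_smul' c X := Subtype.ext (by ext x; simp [EndField.app])

theorem SmoothDistribution.proj_eq_zero {g : Metric E M} (V : SmoothDistribution g) {x : M}
    {v : TangentSpace 𝓘(ℝ, E) x} (h : ∀ w ∈ V.fiber x, g.inner x v w = 0) :
    V.proj.at' x v = 0 := by
  by_contra hne
  have h1 := V.inner_proj_proj x v v
  rw [g.symm x _ v, h _ (V.proj_mem x v)] at h1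
  exact (g.pos x _ hne).ne' h1

/-- An orthogonal `J` with `J² = -1` that preserves `V` also preserves its orthogonal complement. -/
theorem SmoothDistribution.proj_comm {g : Metric E M} (V : SmoothDistribution g)
    {J : EndField E M} (hJ : IsAlmostHermitian g J) (hV : V.IsComplex J) (x : M)
    (v : TangentSpace 𝓘(ℝ, E) x) : V.proj.at' x (J.at' x v) = J.at' x (V.proj.at' x v) := by
  have h1 : V.proj.at' x (J.at' x (v - V.proj.at' x v)) = 0 := by
    refine V.proj_eq_zero fun w hw ↦ ?_
    rw [← hJ.orth, hJ.sq, map_neg, neg_apply, V.proj_orth x v _ (hV x w hw), neg_zero]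
  have h2 := V.proj_of_mem (hV x _ (V.proj_mem x v))
  rw [map_sub, map_sub, h2, sub_eq_zero] at h1
  exact h1

/-- A complex, Riemannian, totally geodesic foliation of a Kähler manifold as an algebraic structure
on smooth vector fields. -/
def kahlerAlgebra {g : Metric E M} {J : EndField E M} (hJ : IsKahler g J)
    (V : SmoothDistribution g) (hcplx : V.IsComplex J) (hriem : V.IsRiemannian)
    (hgeod : V.IsTotallyGeodesic) :
    KahlerFoliation (smoothFields E M) (smoothFunctions E M) where
  toMetricLieAlgebra := metricAlgebra g
  J := J.toLinearMap
  P := V.proj.toLinearMap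
  J_J X := Subtype.ext (by ext x; exact hJ.sq x _)
  met_J_J X Y := Subtype.ext (by ext x; exact hJ.orth x _ _)
  nab_J X Y := Subtype.ext (sub_eq_zero.1 (hJ.parallel X.1 Y.1 X.2 Y.2))
  P_P X := Subtype.ext (by ext x; exact V.proj_proj x _)
  met_P_left X Y := Subtype.ext (by
    ext x
    change g.inner x (V.proj.at' x (X.1 x)) (Y.1 x) = g.inner x (X.1 x) (V.proj.at' x (Y.1 x))
    rw [← V.inner_proj_proj, g.symm, V.inner_proj_proj, g.symm])
  P_J X := Subtype.ext (by ext x; exact V.proj_comm hJ.toIsAlmostHermitian hcplx x _)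
  riemannian U X Y hU hX hY := Subtype.ext (by
    ext x
    have hor (X : smoothFields E M) (hX : V.proj.toLinearMap X = 0) : V.Horizontal X.1 := by
      intro y w hw
      have h1 := V.proj_orth y (X.1 y) w hw
      have h2 : V.proj.at' y (X.1 y) = 0 := congrFun (congrArg Subtype.val hX) y
      rwa [h2, sub_zero] at h1
    refine hriem U.1 X.1 Y.1 U.2 X.2 Y.2 (fun y ↦ ?_) (hor X hX) (hor Y hY) x
    have h2 : V.proj.at' y (U.1 y) = U.1 y := congrFun (congrArg Subtype.val hU) y
    exact h2 ▸ V.proj_mem y _)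
  geodesic U W hU hW := Subtype.ext (by
    have ver (X : smoothFields E M) (hX : V.proj.toLinearMap X = X) : V.Vertical X.1 := by
      intro y
      have h2 : V.proj.at' y (X.1 y) = X.1 y := congrFun (congrArg Subtype.val hX) y
      exact h2 ▸ V.proj_mem y _
    ext x
    exact V.proj_of_mem (hgeod U.1 W.1 U.2 W.2 (ver U hU) (ver W hW) x))

section Kahler

variable {g : Metric E M} {J : EndField E M} (hJ : IsKahler g J)
  (V : SmoothDistribution g) (hcplx : V.IsComplex J) (hriem : V.IsRiemannian)
  (hgeod : V.IsTotallyGeodesic)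

theorem nabla_bott (X Y : smoothFields E M) :
    nabla V.bott X.1 Y.1 = ((kahlerAlgebra hJ V hcplx hriem hgeod).D X Y).1 := by
  rw [KahlerFoliation.D_apply]
  rfl

theorem nkJ_eq (X : smoothFields E M) :
    (V.nkStructure J).app X.1 = ((kahlerAlgebra hJ V hcplx hriem hgeod).nkJ X).1 := rfl

theorem nkMet_eq (X Y : smoothFields E M) :
    (metricAlgebra V.nkMetric).met X Y = (kahlerAlgebra hJ V hcplx hriem hgeod).nkMet X Y := by
  refine Subtype.ext ?_
  ext x
  exact V.variation_inner (1 / 2) (by norm_num) x (X.1 x) (Y.1 x)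

/-- The algebras of `g` and of `g^NK` share brackets and derivatives, so uniqueness of the metric
torsion-free connection applies. -/
theorem nkNab_eq (X Y : smoothFields E M) :
    (metricAlgebra V.nkMetric).nab X Y = (kahlerAlgebra hJ V hcplx hriem hgeod).nkNab X Y := by
  refine (metricAlgebra V.nkMetric).nab_unique (fun X Y Z ↦ ?_) (fun X Y ↦ ?_) X Y
  · simp only [nkMet_eq hJ V hcplx hriem hgeod]
    exact (kahlerAlgebra hJ V hcplx hriem hgeod).der_nkMet X Y Z
  · exact (kahlerAlgebra hJ V hcplx hriem hgeod).nkNab_sub_nkNab X Y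

theorem nabla_nkMetric (X Y : smoothFields E M) :
    nabla (leviCivita V.nkMetric) X.1 Y.1
      = ((kahlerAlgebra hJ V hcplx hriem hgeod).nkNab X Y).1 := by
  rw [← nkNab_eq]
  rfl

theorem nabla_canonicalHermitian (X Y : smoothFields E M) :
    nabla (canonicalHermitian V.nkMetric (V.nkStructure J)) X.1 Y.1
      = ((kahlerAlgebra hJ V hcplx hriem hgeod).D X Y).1 := by
  rw [← KahlerFoliation.nkNab_sub_nkJ]
  have h1 := nabla_nkMetric hJ V hcplx hriem hgeod X Y
  have h2 := nabla_nkMetric hJ V hcplx hriem hgeod X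
    ((kahlerAlgebra hJ V hcplx hriem hgeod).nkJ Y)
  have h3 : nabla (canonicalHermitian V.nkMetric (V.nkStructure J)) X.1 Y.1
      = nabla (leviCivita V.nkMetric) X.1 Y.1 - (1 / 2 : ℝ) • (V.nkStructure J).app
        (nabla (leviCivita V.nkMetric) X.1 ((V.nkStructure J).app Y.1)
          - (V.nkStructure J).app (nabla (leviCivita V.nkMetric) X.1 Y.1)) := rfl
  rw [h3, nkJ_eq hJ V hcplx hriem hgeod, h1, h2]
  rfl

theorem torsionField_canonicalHermitian (X Y : smoothFields E M) :
    torsionField (canonicalHermitian V.nkMetric (V.nkStructure J)) X.1 Y.1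
      = ((kahlerAlgebra hJ V hcplx hriem hgeod).T X Y).1 := by
  have h : torsionField (canonicalHermitian V.nkMetric (V.nkStructure J)) X.1 Y.1
      = nabla (canonicalHermitian V.nkMetric (V.nkStructure J)) X.1 Y.1
        - nabla (canonicalHermitian V.nkMetric (V.nkStructure J)) Y.1 X.1 - bracket X.1 Y.1 := by
    ext x
    exact CovariantDerivative.torsion_apply _ (X.2.diffAt x) (Y.2.diffAt x)
  have h2 : (kahlerAlgebra hJ V hcplx hriem hgeod).T X Y
      = (kahlerAlgebra hJ V hcplx hriem hgeod).D X Y - (kahlerAlgebra hJ V hcplx hriem hgeod).D Y X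
        - (kahlerAlgebra hJ V hcplx hriem hgeod).br X Y := by
    rw [← (kahlerAlgebra hJ V hcplx hriem hgeod).nab_sub_nab, KahlerFoliation.nab_eq,
      KahlerFoliation.nab_eq, KahlerFoliation.T]
    abel
  rw [h, h2, nabla_canonicalHermitian hJ V hcplx hriem hgeod,
    nabla_canonicalHermitian hJ V hcplx hriem hgeod]
  rfl

theorem curvature_canonicalHermitian (X Y Z : smoothFields E M) :
    curvature (canonicalHermitian V.nkMetric (V.nkStructure J)) X.1 Y.1 Z.1
      = ((kahlerAlgebra hJ V hcplx hriem hgeod).RD X Y Z).1 := by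
  have h := nabla_canonicalHermitian hJ V hcplx hriem hgeod
  rw [curvature, h Y Z, h X Z, h, h]
  exact congrArg (_ - ·) (h ((kahlerAlgebra hJ V hcplx hriem hgeod).br X Y) Z)

end Kahler

theorem SmoothDistribution.isAlmostHermitian_nk {g : Metric E M} (V : SmoothDistribution g)
    {J : EndField E M} (hJ : IsAlmostHermitian g J) (hV : V.IsComplex J) :
    IsAlmostHermitian V.nkMetric (V.nkStructure J) := by
  have h (x : M) (v : TangentSpace 𝓘(ℝ, E) x) : (V.nkStructure J).at' x v
      = J.at' x (v - V.proj.at' x v) - J.at' x (V.proj.at' x v) := rfl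
  have hP (x : M) (v : TangentSpace 𝓘(ℝ, E) x) :
      V.proj.at' x ((V.nkStructure J).at' x v) = -J.at' x (V.proj.at' x v) := by
    rw [h, map_sub, V.proj_comm hJ hV, V.proj_comm hJ hV, map_sub, V.proj_proj, sub_self, map_zero,
      zero_sub]
  have hQ (x : M) (v : TangentSpace 𝓘(ℝ, E) x) : (V.nkStructure J).at' x v
      - V.proj.at' x ((V.nkStructure J).at' x v) = J.at' x (v - V.proj.at' x v) := by
    rw [hP, h]
    abel
  constructor
  · intro x v
    rw [h, hQ, hP, map_neg, hJ.sq, hJ.sq]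
    abel
  · intro x v w
    rw [SmoothDistribution.nkMetric, V.variation_inner, V.variation_inner, hQ, hQ, hP, hP,
      hJ.orth, map_neg, map_neg, neg_apply, neg_neg, hJ.orth]

end Concrete

end RiemFol

end

theorem proposition5p2 {n : ℕ} {M : Type*} [TopologicalSpace M] [T2Space M]
    [ChartedSpace (EuclideanSpace ℝ (Fin n)) M]
    [IsManifold 𝓘(ℝ, EuclideanSpace ℝ (Fin n)) ∞ M]
    (g : Metric (EuclideanSpace ℝ (Fin n)) M) (J : EndField (EuclideanSpace ℝ (Fin n)) M)
    (hsym : IsLocallyHermitianSymmetric g J)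
    (V : SmoothDistribution g) (hfol : V.IsFoliation) (hcplx : V.IsComplex J)
    (hriem : V.IsRiemannian) (hgeod : V.IsTotallyGeodesic) :
    IsNearlyKahler V.nkMetric (V.nkStructure J) ∧
      (∀ X Y : VField (EuclideanSpace ℝ (Fin n)) M, IsSmooth X → IsSmooth Y →
        nabla (canonicalHermitian V.nkMetric (V.nkStructure J)) X Y = nabla V.bott X Y) ∧
      IsLocallyHomogeneous V.nkMetric (canonicalHermitian V.nkMetric (V.nkStructure J)) := by
  have hJ := hsym.toIsKahler
  set K := kahlerAlgebra hJ V hcplx hriem hgeod with hK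
  have hD := nabla_canonicalHermitian hJ V hcplx hriem hgeod
  rw [← hK] at hD
  refine ⟨⟨V.isAlmostHermitian_nk hJ.toIsAlmostHermitian hcplx, fun X hX ↦ ?_⟩,
    fun X Y hX hY ↦ ?_, ⟨fun X Y Z hX hY hZ x ↦ ?_, fun W X Y hW hX hY ↦ ?_,
      fun W X Y Z hW hX hY hZ ↦ ?_⟩⟩
  · have h := congrArg Subtype.val (K.nkNab_nkJ_self ⟨X, hX⟩)
    refine sub_eq_zero.2 ?_
    rw [nkJ_eq hJ V hcplx hriem hgeod ⟨X, hX⟩, nabla_nkMetric hJ V hcplx hriem hgeod ⟨X, hX⟩ _,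
      nabla_nkMetric hJ V hcplx hriem hgeod ⟨X, hX⟩ ⟨X, hX⟩]
    exact h
  · rw [hD ⟨X, hX⟩ ⟨Y, hY⟩, nabla_bott hJ V hcplx hriem hgeod ⟨X, hX⟩ ⟨Y, hY⟩]
  · have h := congrFun (congrArg Subtype.val (K.der_nkMet_D ⟨X, hX⟩ ⟨Y, hY⟩ ⟨Z, hZ⟩)) x
    simp only [hK, ← nkMet_eq] at h
    rw [hD ⟨X, hX⟩ ⟨Y, hY⟩, hD ⟨X, hX⟩ ⟨Z, hZ⟩]
    exact h
  · have hT := torsionField_canonicalHermitian hJ V hcplx hriem hgeod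
    rw [hT ⟨X, hX⟩ ⟨Y, hY⟩, hD ⟨W, hW⟩ ⟨X, hX⟩, hD ⟨W, hW⟩ ⟨Y, hY⟩, hT _ ⟨Y, hY⟩, hT ⟨X, hX⟩,
      hD ⟨W, hW⟩]
    exact congrArg Subtype.val (K.D_T ⟨W, hW⟩ ⟨X, hX⟩ ⟨Y, hY⟩)
  · have hR := curvature_canonicalHermitian hJ V hcplx hriem hgeod
    rw [hR ⟨X, hX⟩ ⟨Y, hY⟩ ⟨Z, hZ⟩, hD ⟨W, hW⟩ ⟨X, hX⟩, hD ⟨W, hW⟩ ⟨Y, hY⟩, hD ⟨W, hW⟩ ⟨Z, hZ⟩,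
      hR _ ⟨Y, hY⟩ ⟨Z, hZ⟩, hR ⟨X, hX⟩ _ ⟨Z, hZ⟩, hR ⟨X, hX⟩ ⟨Y, hY⟩, hD ⟨W, hW⟩]
    -- Local symmetry enters only here; everything before uses just the Kähler condition.
    exact congrArg Subtype.val (K.D_RD (fun W X Y Z ↦ Subtype.ext
      (hsym.symmetric W.1 X.1 Y.1 Z.1 W.2 X.2 Y.2 Z.2)) ⟨W, hW⟩ ⟨X, hX⟩ ⟨Y, hY⟩ ⟨Z, hZ⟩)
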